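/- Fix a field $K$; homology has coefficients in $K$, and a simplicial complex is called acyclic if its reduced homology $\tilde H_q$ vanishes for all $q\ge 0$. Let $X$ be a set with a dissimilarity $d:X\times X\to\mathbb R_{\ge 0}$ (symmetric, $d(x,x)=0$), and let $\mathcal U$ be a cover of $X$. For a nonempty finite $\sigma\subseteq X$ put $d(\sigma)=\max_{x,y\in\sigma}d(x,y)$. For $r\ge 0$ let $\mathcal R(X;r)=\{\sigma : d(\sigma)\le r\}$ be the Vietoris–Rips complex and let $\mathcal R(X,\mathcal U;r)=\{\sigma\in\mathcal R(X;r) : \sigma\subseteq U \text{ for some } U\in\mathcal U\}$ be the Vietoris–Rips cover complex. Let $\bar{\mathcal U}$ be the set of intersections of nonempty subfamilies of $\mathcal U$. Define the witness sets $$X(\sigma)=\{y\in X : d(y,x)\le d(\sigma)\ \text{for all } x\in\sigma\},\qquad \bar X(\sigma)=\bigcup_{\emptyset\ne S\subseteq\sigma}X(S),$$ and the restricted cover $\bar{\mathcal U}(\sigma)=\{V\cap\bar X(\sigma) : V\in\bar{\mathcal U},\ V\cap\bar X(\sigma)\neq\emptyset\}$; let $\mathcal N$ denote the nerve. Define initial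 segments $I_1,I_2,I_3$ of $\mathbb R_{\ge0}$ by * $r\in I_1$ iff every $\sigma$ with $d(\sigma)\le r$ is contained in some $U\in\mathcal U$; * $r\in I_2$ iff for every $\sigma$ with $d(\sigma)\le r$, $\mathcal N(\bar{\mathcal U}(\sigma))$ is acyclic and $X(\sigma)\cap V\ne\emptyset$ for each $V\in\bar{\mathcal U}(\sigma)$; * $r\in I_3$ iff for every $\sigma$ with $d(\sigma)\le r$, $\mathcal N(\bar{\mathcal U}(\sigma))$ is acyclic. The threshold $R_j$ is the largest element of $I_j$, and "$r\le R_j$" means $r\in I_j$ (also when $I_j$ has no largest element). For $T\subseteq\mathbb R_{\ge0}$ and a non-decreasing $\alpha:\mathbb R_{\ge0}\to\mathbb R_{\ge0}$, say that $H_k(\mathcal R(X,\mathcal U;r))$ and $H_k(\mathcal R(X;r))$ are $(\mathrm{id},\alpha)$-interleaved for $r\in T$ if there are linear maps $F_r:H_k(\mathcal R(X,\mathcal U;r))\to H_k(\mathcal R(X;r))$ for all $r\ge 0$, and $G_r:H_k(\mathcal R(X;r))\to H_k(\mathcal R(X,\mathcal U;\alpha(r)))$ for $r\in T$, each family commuting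 with the maps induced by inclusions as $r$ varies, such that for every $r\in T$ we have $r\le\alpha(r)$ and both $G_r\circ F_r$ and $F_{\alpha(r)}\circ G_r$ are the maps induced by the inclusions from parameter $r$ to parameter $\alpha(r)$. Then the following hold. 1. $\mathcal R(X,\mathcal U;r)=\mathcal R(X;r)$ for all $r\le R_1$. 2. If $d$ satisfies the triangle inequality (for example, if $d$ is a metric), there is a non-decreasing $\alpha:\mathbb R_{\ge0}\to\mathbb R_{\ge0}$ with $\alpha(r)\ge r$ for all $r$, $\alpha(r)=r$ for $r\le R_1$, $\alpha(r)\le 2r$ for $r\le R_2$ and $\alpha(r)\le 3r$ for $r\le R_3$, such that for every $k\ge0$, $H_k(\mathcal R(X,\mathcal U;r))$ and $H_k(\mathcal R(X;r))$ are $(\mathrm{id},\alpha)$-interleaved for $r\in I_1\cup I_2\cup I_3$. In particular, for every $k$ they are $(\mathrm{id},2r)$-interleaved for $r\le R_2$ and $(\mathrm{id},3r)$-interleaved for $r\le R_3$. 3. For $r>R_3$ an interleaving may not exist: for every field $K$ there are a finite metric space, a cover of it with $\emptyset\neq I_3\ne\mathbb R_{\ge0}$, and a $k$, such that for no set $T\not\subseteq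 I_3$ and no non-decreasing $\alpha$ are the two homologies in degree $k$ $(\mathrm{id},\alpha)$-interleaved for $r\in T$. -/

import Mathlib

open scoped NNReal
open CategoryTheory

universe u v

namespace RipsCover

/-! ### Simplicial homology with field coefficients -/

section Subquotient

variable {K : Type v} [Field K] {M : Type u} [AddCommGroup M] [Module K M]

/-- The quotient `Z / (B ∩ Z)` of subspaces of a vector space. -/
abbrev Subquotient (Z B : Submodule K M) : Type u := ↥Z ⧸ B.submoduleOf Z

/-- The map `Z / (B ∩ Z) → Z' / (B' ∩ Z')` induced by inclusions `Z ≤ Z'` and `B ≤ B'`. -/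
def Subquotient.map {Z B Z' B' : Submodule K M} (hZ : Z ≤ Z') (hB : B ≤ B') :
    Subquotient Z B →ₗ[K] Subquotient Z' B' :=
  Submodule.mapQ _ _ (Submodule.inclusion hZ) fun _ hz => hB hz

theorem Subquotient.map_self {Z B : Submodule K M} (hZ : Z ≤ Z) (hB : B ≤ B) :
    Subquotient.map hZ hB = LinearMap.id := by
  ext z
  rfl

theorem Subquotient.map_map {Z B Z' B' Z'' B'' : Submodule K M} (hZ : Z ≤ Z') (hB : B ≤ B')
    (hZ' : Z' ≤ Z'') (hB' : B' ≤ B'') :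
    Subquotient.map hZ' hB' ∘ₗ Subquotient.map hZ hB =
      Subquotient.map (hZ.trans hZ') (hB.trans hB') := by
  ext z
  rfl

end Subquotient

section Homology

variable (K : Type v) [Field K] {V : Type u}

/-- Ordered `n`-chains on the vertex set `V`: the free `K`-vector space on `(n+1)`-tuples of
vertices. -/
abbrev Chain (K : Type v) [Field K] (V : Type u) (n : ℕ) : Type (max u v) :=
  (Fin (n + 1) → V) →₀ K

/-- The boundary map `(x₀,…,xₙ₊₁) ↦ ∑ᵢ (-1)ⁱ (x₀,…,x̂ᵢ,…,xₙ₊₁)`. -/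
noncomputable def boundary (V : Type u) (n : ℕ) : Chain K V (n + 1) →ₗ[K] Chain K V n :=
  Finsupp.linearCombination K fun x : Fin (n + 2) → V =>
    ∑ i : Fin (n + 2), Finsupp.single (x ∘ i.succAbove) ((-1 : K) ^ (i : ℕ))

/-- The augmentation of `0`-chains, sending every vertex to `1`. -/
noncomputable def augmentation (V : Type u) : Chain K V 0 →ₗ[K] K :=
  Finsupp.linearCombination K fun _ : Fin 1 → V => (1 : K)

/-- The ordered chains of a simplicial complex: those supported on the tuples (repetitions
allowed) whose set of entries is a simplex. The homology of this complex is simplicial homology. -/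
def chains (Δ : PreAbstractSimplicialComplex V) (n : ℕ) : Submodule K (Chain K V n) :=
  Finsupp.supported K K {x : Fin (n + 1) → V | (Set.finite_range x).toFinset ∈ Δ}

/-- The `n`-cycles of a simplicial complex. -/
noncomputable def cycles (Δ : PreAbstractSimplicialComplex V) :
    (n : ℕ) → Submodule K (Chain K V n)
  | 0 => chains K Δ 0
  | n + 1 => chains K Δ (n + 1) ⊓ LinearMap.ker (boundary K V n)

/-- The cycles of the augmented chain complex. -/
noncomputable def reducedCycles (Δ : PreAbstractSimplicialComplex V) :
    (n : ℕ) → Submodule K (Chain K V n)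
  | 0 => chains K Δ 0 ⊓ LinearMap.ker (augmentation K V)
  | n + 1 => chains K Δ (n + 1) ⊓ LinearMap.ker (boundary K V n)

/-- The `n`-boundaries of a simplicial complex. -/
noncomputable def boundaries (Δ : PreAbstractSimplicialComplex V) (n : ℕ) :
    Submodule K (Chain K V n) :=
  (chains K Δ (n + 1)).map (boundary K V n)

/-- A simplicial complex is acyclic (over `K`) if its reduced homology vanishes in all
degrees `q ≥ 0`. -/
def Acyclic (Δ : PreAbstractSimplicialComplex V) : Prop :=
  ∀ q : ℕ, reducedCycles K Δ q ≤ boundaries K Δ q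

/-- The simplicial homology `Hₙ(Δ; K)`: cycles modulo boundaries. -/
abbrev Homology (Δ : PreAbstractSimplicialComplex V) (n : ℕ) : Type (max u v) :=
  Subquotient (cycles K Δ n) (boundaries K Δ n)

theorem chains_mono {Δ Δ' : PreAbstractSimplicialComplex V} (h : Δ ≤ Δ') (n : ℕ) :
    chains K Δ n ≤ chains K Δ' n :=
  Finsupp.supported_mono fun _ hx => h hx

theorem cycles_mono {Δ Δ' : PreAbstractSimplicialComplex V} (h : Δ ≤ Δ') :
    (n : ℕ) → cycles K Δ n ≤ cycles K Δ' n
  | 0 => chains_mono K h 0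
  | n + 1 => inf_le_inf_right _ (chains_mono K h (n + 1))

theorem boundaries_mono {Δ Δ' : PreAbstractSimplicialComplex V} (h : Δ ≤ Δ') (n : ℕ) :
    boundaries K Δ n ≤ boundaries K Δ' n :=
  Submodule.map_mono (chains_mono K h (n + 1))

/-- The map on homology induced by an inclusion of simplicial complexes. -/
noncomputable def homologyMap {Δ Δ' : PreAbstractSimplicialComplex V} (h : Δ ≤ Δ') (n : ℕ) :
    Homology K Δ n →ₗ[K] Homology K Δ' n :=
  Subquotient.map (cycles_mono K h n) (boundaries_mono K h n)

/-- The persistence vector space `t ↦ Hₙ(F t; K)` of a filtered simplicial complex `F`, with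
transition maps induced by the inclusions. -/
noncomputable def persistentHomology (F : ℝ≥0 →o PreAbstractSimplicialComplex V) (n : ℕ) :
    ℝ≥0 ⥤ ModuleCat.{max u v} K where
  obj t := ModuleCat.of K (Homology K (F t) n)
  map f := ModuleCat.ofHom (homologyMap K (F.monotone (leOfHom f)) n)
  map_id _ := ModuleCat.hom_ext (Subquotient.map_self _ le_rfl)
  map_comp f g := ModuleCat.hom_ext (Subquotient.map_map _
    (boundaries_mono K (F.monotone (leOfHom f)) n) _
    (boundaries_mono K (F.monotone (leOfHom g)) n)).symm

end Homology

/-! ### Shift maps and interleavings -/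

section Interleaving

variable {K : Type v} [Field K]

/-- An `α`-shift map from `M` to `N`, given at the parameters `s ∈ S`: linear maps
`M s → N (α s)` commuting with the transition maps. For `S = Set.univ` this is an `α`-shift map
of persistence vector spaces. -/
structure ShiftMap (M N : ℝ≥0 ⥤ ModuleCat.{max u v} K) (S : Set ℝ≥0) (α : ℝ≥0 →o ℝ≥0) where
  app : ∀ s : S, M.obj (s : ℝ≥0) ⟶ N.obj (α s)
  comm : ∀ (s t : S) (h : (s : ℝ≥0) ≤ t),
    app s ≫ N.map (homOfLE (α.monotone h)) = M.map (homOfLE h) ≫ app t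

/-- `M`, at the parameters in `S`, and `N`, at the parameters in `T`, are `(α, β)`-interleaved:
there are an `α`-shift map `F : M → N` on `S` and a `β`-shift map `G : N → M` on `T` such that
both composites agree with the transition maps wherever they are defined. For
`S = T = Set.univ` this is an `(α, β)`-interleaving of persistence vector spaces. -/
def Interleaved (M N : ℝ≥0 ⥤ ModuleCat.{max u v} K) (S T : Set ℝ≥0) (α β : ℝ≥0 →o ℝ≥0) : Prop :=
  ∃ (F : ShiftMap M N S α) (G : ShiftMap N M T β),
    (∀ (s : S) (hs : α s ∈ T), ∃ h : (s : ℝ≥0) ≤ β (α s),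
      F.app s ≫ G.app ⟨α s, hs⟩ = M.map (homOfLE h)) ∧
    (∀ (t : T) (ht : β t ∈ S), ∃ h : (t : ℝ≥0) ≤ α (β t),
      G.app t ≫ F.app ⟨β t, ht⟩ = N.map (homOfLE h))

/-- The shift `r ↦ c * r`. -/
def scale (c : ℝ≥0) : ℝ≥0 →o ℝ≥0 where
  toFun r := c * r
  monotone' _ _ h := mul_le_mul_right h c

end Interleaving

/-! ### Dissimilarities, Vietoris–Rips complexes and cover complexes -/

/-- A dissimilarity on `X`. -/
structure Dissimilarity (X : Type u) where
  dist : X → X → ℝ≥0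
  dist_self : ∀ x, dist x x = 0
  dist_comm : ∀ x y, dist x y = dist y x

namespace Dissimilarity

variable {X : Type u} (d : Dissimilarity X)

/-- The triangle inequality. -/
def Triangle : Prop := ∀ x y z, d.dist x z ≤ d.dist x y + d.dist y z

/-- `d(x₀,…,xₖ)`: the largest dissimilarity between two of the points (`0` for one point). -/
noncomputable def diam (σ : Finset X) : ℝ≥0 := (σ ×ˢ σ).sup fun p => d.dist p.1 p.2

theorem diam_mono {σ τ : Finset X} (h : σ ⊆ τ) : d.diam σ ≤ d.diam τ :=
  Finset.sup_mono (Finset.product_subset_product h h)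

/-- The Vietoris–Rips filtration of `(X, d)`. -/
noncomputable def rips : ℝ≥0 →o PreAbstractSimplicialComplex X where
  toFun r :=
    { faces := {σ | σ.Nonempty ∧ d.diam σ ≤ r}
      isRelLowerSet_faces := fun _ hσ =>
        ⟨hσ.1, fun _ hτ hne => ⟨hne, (d.diam_mono hτ).trans hσ.2⟩⟩ }
  monotone' _ _ h := fun _ hσ => ⟨hσ.1, hσ.2.trans h⟩

/-- The Vietoris–Rips cover complex, as a filtration: the simplices of the Vietoris–Rips complex
whose vertices lie in a common set of the cover `U`. -/
noncomputable def coverRips (U : Set (Set X)) : ℝ≥0 →o PreAbstractSimplicialComplex X where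
  toFun r :=
    { faces := {σ | σ ∈ d.rips r ∧ ∃ A ∈ U, (σ : Set X) ⊆ A}
      isRelLowerSet_faces := by
        rintro σ ⟨hσ, A, hA, hσA⟩
        refine ⟨hσ.1, fun τ hτ hne => ⟨⟨hne, (d.diam_mono hτ).trans hσ.2⟩, A, hA, ?_⟩⟩
        exact (Finset.coe_subset.2 hτ).trans hσA }
  monotone' _ _ h := fun _ hσ => ⟨d.rips.monotone h hσ.1, hσ.2⟩

/-- The witness set of `x₀,…,xₖ`: the points `y` with `d(y, xᵢ) ≤ d(x₀,…,xₖ)` for all `i`. -/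
def witness (σ : Finset X) : Set X := {y | ∀ x ∈ σ, d.dist y x ≤ d.diam σ}

/-- The union of the witness sets of the nonempty subsets of `{x₀,…,xₖ}`. -/
def witnessUnion (σ : Finset X) : Set X :=
  {y | ∃ S : Finset X, S ⊆ σ ∧ S.Nonempty ∧ y ∈ d.witness S}

end Dissimilarity

/-- The refinement of a cover by all intersections of nonempty subfamilies. -/
def refinement {X : Type u} (U : Set (Set X)) : Set (Set X) :=
  {A | ∃ I ⊆ U, I.Nonempty ∧ A = ⋂₀ I}

/-- The nerve of a family of sets: its simplices are the nonempty finite subfamilies with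
nonempty intersection. -/
def nerve {X : Type u} (U : Set (Set X)) : PreAbstractSimplicialComplex (Set X) where
  faces := {s | s.Nonempty ∧ (s : Set (Set X)) ⊆ U ∧ (⋂₀ (s : Set (Set X))).Nonempty}
  isRelLowerSet_faces := fun _ hs =>
    ⟨hs.1, fun _ ht hne =>
      ⟨hne, (Finset.coe_subset.2 ht).trans hs.2.1,
        hs.2.2.mono (Set.sInter_subset_sInter (Finset.coe_subset.2 ht))⟩⟩

namespace Dissimilarity

variable {X : Type u} (d : Dissimilarity X)

/-- The nonempty traces, on the union of the witness sets of `σ`, of the sets of the refined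
cover. -/
def restrictedCover (U : Set (Set X)) (σ : Finset X) : Set (Set X) :=
  {B | ∃ A ∈ refinement U, B = A ∩ d.witnessUnion σ ∧ B.Nonempty}

/-- The parameters `r` such that all tuples of diameter at most `r` lie in a set of the cover.
The threshold `R₁` is the largest such `r`. -/
def regime₁ (U : Set (Set X)) : Set ℝ≥0 :=
  {r | ∀ σ : Finset X, σ.Nonempty → d.diam σ ≤ r → ∃ A ∈ U, (σ : Set X) ⊆ A}

/-- The parameters `r` such that, for all tuples of diameter at most `r`, the nerve of the
restricted cover is acyclic and each of its sets contains a witness of the whole tuple.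
The threshold `R₂` is the largest such `r`. -/
def regime₂ (K : Type v) [Field K] (U : Set (Set X)) : Set ℝ≥0 :=
  {r | ∀ σ : Finset X, σ.Nonempty → d.diam σ ≤ r →
    Acyclic K (nerve (d.restrictedCover U σ)) ∧
      ∀ B ∈ d.restrictedCover U σ, (d.witness σ ∩ B).Nonempty}

/-- The parameters `r` such that, for all tuples of diameter at most `r`, the nerve of the
restricted cover is acyclic. The threshold `R₃` is the largest such `r`. -/
def regime₃ (K : Type v) [Field K] (U : Set (Set X)) : Set ℝ≥0 :=
  {r | ∀ σ : Finset X, σ.Nonempty → d.diam σ ≤ r → Acyclic K (nerve (d.restrictedCover U σ))}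

theorem isLowerSet_regime₁ (U : Set (Set X)) : IsLowerSet (d.regime₁ U) :=
  fun _ _ h hr σ hσ hd => hr σ hσ (hd.trans h)

theorem isLowerSet_regime₂ (K : Type v) [Field K] (U : Set (Set X)) :
    IsLowerSet (d.regime₂ K U) :=
  fun _ _ h hr σ hσ hd => hr σ hσ (hd.trans h)

theorem isLowerSet_regime₃ (K : Type v) [Field K] (U : Set (Set X)) :
    IsLowerSet (d.regime₃ K U) :=
  fun _ _ h hr σ hσ hd => hr σ hσ (hd.trans h)

theorem regime₂_subset_regime₃ (K : Type v) [Field K] (U : Set (Set X)) :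
    d.regime₂ K U ⊆ d.regime₃ K U :=
  fun _ hr σ hσ hd => (hr σ hσ hd).1

end Dissimilarity

/-- For an initial segment `I` with a largest element `R`, membership in `I` means `r ≤ R`. -/
theorem mem_iff_le_of_isGreatest {I : Set ℝ≥0} (hI : IsLowerSet I) {R : ℝ≥0}
    (hR : IsGreatest I R) (r : ℝ≥0) : r ∈ I ↔ r ≤ R :=
  ⟨fun h => hR.2 h, fun h => hI h hR.1⟩

end RipsCover

/-! The map `G` from the Rips complex back to the cover complex comes from acyclic carriers. For a
factor `c > 1`, a simplex `σ` is assigned the subcomplex of the cover complex whose simplices have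
vertices in the witness union of `σ` and diameter at most `c * d.diam σ`; for `c = 1` it is the full
simplex on `σ`. A monotone acyclic carrier carries a chain map (`isCarried_carrierMap`), unique up
to homotopy (`IsCarried.exists_boundary`). Naturality and both composite identities then hold
because the two sides share an acyclic carrier (`interleaved_of_carriers`). For `F ∘ G` the identity
need not be carried by the cover carrier, as `σ` may lie in no cover set; there the carrier for the
trivial cover `{Set.univ}` is used instead.

Acyclicity for `c = 2, 3` follows from a nerve theorem (`augExact_coverSubcomplex`). The restricted
cover is closed under nonempty intersections, its nerve is acyclic by hypothesis, and on each of its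
members the Rips complex at scale `c * d.diam σ` is a cone by the triangle inequality: the apex is a
witness of all of `σ` when `c = 2`, and any point when `c = 3`. The nerve theorem is again proved by
carriers: acyclicity passes from the nerve to the order complex, and from there to the union, by
`AugExact.of_retract`.

The counterexample is two points at distance `1`, covered by singletons. The cover complex keeps two
components at every scale, while the Rips complex is connected from scale `1` on, so the
inclusion-induced map on `H₀` cannot factor through it. -/

namespace RipsCover

/-! ### The augmented ordered chain complex -/

section Augmented

variable (K : Type v) [Field K] {V W : Type*}

/-- Augmented ordered chains, indexed by the number of entries of the tuples. -/
abbrev TupleChain (K : Type v) [Field K] (V : Type*) (n : ℕ) := (Fin n → V) →₀ K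

/-- The boundary map of the augmented ordered chain complex. -/
noncomputable def tupleBoundary (V : Type*) (n : ℕ) :
    TupleChain K V (n + 1) →ₗ[K] TupleChain K V n :=
  Finsupp.linearCombination K fun x : Fin (n + 1) → V =>
    ∑ i : Fin (n + 1), Finsupp.single (x ∘ i.succAbove) ((-1 : K) ^ (i : ℕ))

/-- The cone operator, which prepends a vertex. -/
noncomputable def coneOp (v : V) (n : ℕ) : TupleChain K V n →ₗ[K] TupleChain K V (n + 1) :=
  Finsupp.lmapDomain K K fun x => Fin.cons v x

theorem tupleBoundary_single {n : ℕ} (x : Fin (n + 1) → V) :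
    tupleBoundary K V n (Finsupp.single x 1) =
      ∑ i : Fin (n + 1), Finsupp.single (x ∘ i.succAbove) ((-1 : K) ^ (i : ℕ)) := by
  simp [tupleBoundary]

theorem coneOp_single (v : V) {n : ℕ} (x : Fin n → V) (a : K) :
    coneOp K v n (Finsupp.single x a) = Finsupp.single (Fin.cons v x) a := by
  simp [coneOp, Finsupp.lmapDomain_apply, Finsupp.mapDomain_single]

theorem cons_comp_succAbove_succ (v : V) {n : ℕ} (x : Fin (n + 1) → V) (i : Fin (n + 1)) :
    (Fin.cons v x : Fin (n + 2) → V) ∘ i.succ.succAbove =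
      (Fin.cons v (x ∘ i.succAbove) : Fin (n + 1) → V) := by
  funext j
  refine Fin.cases ?_ (fun j => ?_) j
  · simp
  · simp [Fin.succ_succAbove_succ]

theorem tupleBoundary_coneOp_zero (v : V) (z : TupleChain K V 0) :
    tupleBoundary K V 0 (coneOp K v 0 z) = z := by
  have : tupleBoundary K V 0 ∘ₗ coneOp K v 0 = LinearMap.id := by
    refine Finsupp.lhom_ext' fun x => LinearMap.ext_ring ?_
    simp only [LinearMap.comp_apply, Finsupp.lsingle_apply, coneOp_single, tupleBoundary_single]
    simp [Subsingleton.elim _ x]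
  exact LinearMap.congr_fun this z

/-- Deleting the new first entry gives back the tuple; deleting any later entry commutes with
prepending, with the sign shifted by one. This identity drives both `∂∂ = 0` and the acyclicity of
cones. -/
theorem tupleBoundary_coneOp (v : V) (n : ℕ) (z : TupleChain K V (n + 1)) :
    tupleBoundary K V (n + 1) (coneOp K v (n + 1) z) =
      z - coneOp K v n (tupleBoundary K V n z) := by
  have : tupleBoundary K V (n + 1) ∘ₗ coneOp K v (n + 1) =
      LinearMap.id - coneOp K v n ∘ₗ tupleBoundary K V n := by
    refine Finsupp.lhom_ext' fun x => LinearMap.ext_ring ?_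
    simp only [LinearMap.comp_apply, LinearMap.sub_apply, Finsupp.lsingle_apply, coneOp_single,
      tupleBoundary_single, map_sum, LinearMap.id_apply]
    rw [Fin.sum_univ_succ, sub_eq_add_neg, ← Finset.sum_neg_distrib]
    congr 1
    · simp only [Fin.val_zero, pow_zero]
      congr 1
    · refine Finset.sum_congr rfl fun i _ => ?_
      rw [cons_comp_succAbove_succ, ← Finsupp.single_neg]
      simp [pow_succ]
  exact LinearMap.congr_fun this z

theorem tupleBoundary_tupleBoundary (n : ℕ) (z : TupleChain K V (n + 2)) :
    tupleBoundary K V n (tupleBoundary K V (n + 1) z) = 0 := by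
  have : tupleBoundary K V n ∘ₗ tupleBoundary K V (n + 1) = 0 := by
    clear z
    refine Finsupp.lhom_ext' fun x => LinearMap.ext_ring ?_
    -- Every tuple is a cone `v * y` over its tail, so `∂∂(v * y) = ∂y - ∂(v * ∂y)`, and the cone
    -- formula reduces this to `∂∂y = 0` for a shorter tuple.
    rw [← Fin.cons_self_tail x]
    simp only [LinearMap.comp_apply, Finsupp.lsingle_apply, LinearMap.zero_apply]
    rw [← coneOp_single, tupleBoundary_coneOp, map_sub]
    induction n with
    | zero => rw [tupleBoundary_coneOp_zero, sub_self]
    | succ n ih =>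
      have h := LinearMap.congr_fun (f := tupleBoundary K V n ∘ₗ tupleBoundary K V (n + 1))
        (g := 0) (Finsupp.lhom_ext' fun y => LinearMap.ext_ring (by
          rw [← Fin.cons_self_tail y]
          simpa only [LinearMap.comp_apply, Finsupp.lsingle_apply, LinearMap.zero_apply,
            ← coneOp_single, tupleBoundary_coneOp, map_sub] using ih y))
      simp only [LinearMap.comp_apply, LinearMap.zero_apply] at h
      rw [tupleBoundary_coneOp, h, map_zero, sub_zero, sub_self]
  exact LinearMap.congr_fun this z

/-- The set of entries of a tuple. -/
noncomputable abbrev entries {n : ℕ} (x : Fin n → V) : Finset V := (Set.finite_range x).toFinset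

/-- The augmented ordered chains of a simplicial complex. -/
def tupleChains (Δ : PreAbstractSimplicialComplex V) (n : ℕ) : Submodule K (TupleChain K V n) :=
  -- The empty set is never a face, so the empty tuple, which spans the augmentation term, is
  -- admitted separately.
  Finsupp.supported K K {x : Fin n → V | n = 0 ∨ entries x ∈ Δ}

variable {K}

theorem tupleChains_mono {Δ Δ' : PreAbstractSimplicialComplex V} (h : Δ ≤ Δ') (n : ℕ) :
    tupleChains K Δ n ≤ tupleChains K Δ' n :=
  Finsupp.supported_mono fun _ hx => hx.imp_right fun hx => h hx

theorem mem_tupleChains_zero (Δ : PreAbstractSimplicialComplex V) (z : TupleChain K V 0) :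
    z ∈ tupleChains K Δ 0 :=
  (Finsupp.mem_supported K _).2 fun _ _ => Or.inl rfl

theorem single_mem_tupleChains {Δ : PreAbstractSimplicialComplex V} {n : ℕ} {x : Fin n → V}
    (hx : n = 0 ∨ entries x ∈ Δ) (a : K) : Finsupp.single x a ∈ tupleChains K Δ n :=
  Finsupp.single_mem_supported K a hx

/-- A property of chains that is linear needs to be checked on the tuples only. -/
theorem map_mem_of_single {M : Type*} [AddCommGroup M] [Module K M]
    {Δ : PreAbstractSimplicialComplex V} {n : ℕ} (f : TupleChain K V n →ₗ[K] M)
    (P : Submodule K M)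
    (h : ∀ x : Fin n → V, (n = 0 ∨ entries x ∈ Δ) → f (Finsupp.single x 1) ∈ P)
    {z : TupleChain K V n} (hz : z ∈ tupleChains K Δ n) : f z ∈ P := by
  have : tupleChains K Δ n ≤ P.comap f := by
    rw [tupleChains, Finsupp.supported_eq_span_single, Submodule.span_le]
    rintro _ ⟨x, hx, rfl⟩
    exact h x hx
  exact this hz

theorem map_eq_of_single {M : Type*} [AddCommGroup M] [Module K M]
    {Δ : PreAbstractSimplicialComplex V} {n : ℕ} {f g : TupleChain K V n →ₗ[K] M}
    (h : ∀ x : Fin n → V, (n = 0 ∨ entries x ∈ Δ) →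
      f (Finsupp.single x 1) = g (Finsupp.single x 1))
    {z : TupleChain K V n} (hz : z ∈ tupleChains K Δ n) : f z = g z := by
  have := map_mem_of_single (f - g) ⊥ (fun x hx => by simp [h x hx]) hz
  simpa [sub_eq_zero] using this

theorem entries_comp_subset {m n : ℕ} (x : Fin n → V) (g : Fin m → Fin n) :
    entries (x ∘ g) ⊆ entries x := by
  intro v hv
  simp only [entries, Set.Finite.mem_toFinset] at hv ⊢
  exact Set.range_comp_subset_range _ _ hv

theorem entries_nonempty {n : ℕ} (x : Fin (n + 1) → V) : (entries x).Nonempty :=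
  ⟨x 0, by simp [entries]⟩

theorem mem_of_subset {Δ : PreAbstractSimplicialComplex V} {σ τ : Finset V} (hσ : σ ∈ Δ)
    (h : τ ⊆ σ) (hτ : τ.Nonempty) : τ ∈ Δ :=
  Δ.isRelLowerSet_faces.mem_of_le hσ h hτ

theorem nonempty_of_mem {Δ : PreAbstractSimplicialComplex V} {σ : Finset V} (hσ : σ ∈ Δ) :
    σ.Nonempty :=
  (Δ.isRelLowerSet_faces hσ).1

theorem tupleBoundary_mem {Δ : PreAbstractSimplicialComplex V} {n : ℕ}
    {z : TupleChain K V (n + 1)} (hz : z ∈ tupleChains K Δ (n + 1)) :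
    tupleBoundary K V n z ∈ tupleChains K Δ n := by
  refine map_mem_of_single _ _ (fun x hx => ?_) hz
  rw [tupleBoundary_single]
  refine Submodule.sum_mem _ fun i _ => single_mem_tupleChains ?_ _
  rcases n with _ | n
  · exact Or.inl rfl
  · exact Or.inr (mem_of_subset (hx.resolve_left (Nat.succ_ne_zero _))
      (entries_comp_subset _ _) (entries_nonempty _))

/-- The simplices of `Δ` with all vertices in `A`. -/
def restrict (Δ : PreAbstractSimplicialComplex V) (A : Set V) :
    PreAbstractSimplicialComplex V where
  faces := {σ | σ ∈ Δ ∧ (σ : Set V) ⊆ A}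
  isRelLowerSet_faces := fun _ hσ => ⟨nonempty_of_mem hσ.1, fun _ hτ hne =>
    ⟨mem_of_subset hσ.1 hτ hne, (Finset.coe_subset.2 hτ).trans hσ.2⟩⟩

theorem mem_restrict {Δ : PreAbstractSimplicialComplex V} {A : Set V} {σ : Finset V} :
    σ ∈ restrict Δ A ↔ σ ∈ Δ ∧ (σ : Set V) ⊆ A :=
  Iff.rfl

theorem restrict_le (Δ : PreAbstractSimplicialComplex V) (A : Set V) : restrict Δ A ≤ Δ :=
  fun _ hσ => hσ.1

theorem restrict_mono (Δ : PreAbstractSimplicialComplex V) {A B : Set V} (h : A ⊆ B) :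
    restrict Δ A ≤ restrict Δ B :=
  fun _ hσ => ⟨hσ.1, hσ.2.trans h⟩

variable (K)

/-- Exactness of the augmented ordered chain complex, including degree `-1`. -/
def AugExact (Δ : PreAbstractSimplicialComplex V) : Prop :=
  ∀ (n : ℕ), ∀ z ∈ tupleChains K Δ n,
    -- For `n = 0` the condition is vacuous: every multiple of the empty tuple must be a boundary,
    -- which forces `Δ` to have a vertex.
    (∀ (m : ℕ) (h : n = m + 1), tupleBoundary K V m (h ▸ z) = 0) →
    ∃ w ∈ tupleChains K Δ (n + 1), tupleBoundary K V n w = z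

variable {K}

theorem AugExact.exists_zero {Δ : PreAbstractSimplicialComplex V} (h : AugExact K Δ)
    (z : TupleChain K V 0) :
    ∃ w ∈ tupleChains K Δ 1, tupleBoundary K V 0 w = z :=
  h 0 z (mem_tupleChains_zero Δ z) fun _ h => absurd h.symm (Nat.succ_ne_zero _)

theorem AugExact.exists_succ {Δ : PreAbstractSimplicialComplex V} (h : AugExact K Δ) {n : ℕ}
    {z : TupleChain K V (n + 1)} (hz : z ∈ tupleChains K Δ (n + 1))
    (hb : tupleBoundary K V n z = 0) :
    ∃ w ∈ tupleChains K Δ (n + 2), tupleBoundary K V (n + 1) w = z :=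
  h (n + 1) z hz fun m hm => by
    obtain rfl : n = m := Nat.succ_injective hm
    exact hb

theorem augExact_iff {Δ : PreAbstractSimplicialComplex V} :
    AugExact K Δ ↔ (∀ z, ∃ w ∈ tupleChains K Δ 1, tupleBoundary K V 0 w = z) ∧
      ∀ n, ∀ z ∈ tupleChains K Δ (n + 1), tupleBoundary K V n z = 0 →
        ∃ w ∈ tupleChains K Δ (n + 2), tupleBoundary K V (n + 1) w = z := by
  refine ⟨fun h => ⟨h.exists_zero, fun n z hz hb => h.exists_succ hz hb⟩, fun h n z hz hb => ?_⟩
  rcases n with _ | n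
  · exact h.1 z
  · exact h.2 n z hz (hb n rfl)

/-- A cone is acyclic. -/
theorem augExact_of_cone [DecidableEq V] {Δ : PreAbstractSimplicialComplex V} (v : V)
    (hv : {v} ∈ Δ) (h : ∀ σ ∈ Δ, insert v σ ∈ Δ) : AugExact K Δ := by
  have key : ∀ n, ∀ z ∈ tupleChains K Δ n, coneOp K v n z ∈ tupleChains K Δ (n + 1) := by
    intro n z hz
    refine map_mem_of_single _ _ (fun x hx => ?_) hz
    rw [coneOp_single]
    refine single_mem_tupleChains (Or.inr ?_) _
    have hc : entries (Fin.cons v x : Fin (n + 1) → V) = insert v (entries x) := by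
      ext w
      simp [entries, Fin.range_cons]
    rw [hc]
    rcases hx with rfl | hx
    · have : entries x = ∅ := by
        ext w
        simp [entries]
      simpa [this] using hv
    · exact h _ hx
  refine augExact_iff.2 ⟨fun z => ⟨coneOp K v 0 z, key 0 z (mem_tupleChains_zero Δ z),
    tupleBoundary_coneOp_zero K v z⟩, fun n z hz hb => ⟨coneOp K v _ z, key _ z hz, ?_⟩⟩
  rw [tupleBoundary_coneOp, hb, map_zero, sub_zero]

end Augmented

/-! ### Acyclic carriers -/

section Carriers

variable {K : Type v} [Field K] {V W : Type*}

/-- `φ` is an augmentation-preserving chain map on the chains of `Δ`, carried by `Φ`. -/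
structure IsCarried (Δ : PreAbstractSimplicialComplex V)
    (Φ : Finset V → PreAbstractSimplicialComplex W)
    (φ : ∀ n, TupleChain K V n →ₗ[K] TupleChain K W n) : Prop where
  -- The empty tuple goes to the empty tuple; this encodes preservation of the augmentation.
  zero : φ 0 = Finsupp.lmapDomain K K fun _ => Fin.elim0
  mem : ∀ (n : ℕ) (x : Fin (n + 1) → V), entries x ∈ Δ →
    φ (n + 1) (Finsupp.single x 1) ∈ tupleChains K (Φ (entries x)) (n + 1)
  comm : ∀ n, ∀ z ∈ tupleChains K Δ (n + 1),
    tupleBoundary K W n (φ (n + 1) z) = φ n (tupleBoundary K V n z)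

/-- A carrier on `Δ` is monotone on the simplices of `Δ`. -/
def MonoCarrier (Δ : PreAbstractSimplicialComplex V)
    (Φ : Finset V → PreAbstractSimplicialComplex W) : Prop :=
  ∀ σ ∈ Δ, ∀ τ ∈ Δ, σ ⊆ τ → Φ σ ≤ Φ τ

theorem IsCarried.mono {Δ Δ' : PreAbstractSimplicialComplex V}
    {Φ Φ' : Finset V → PreAbstractSimplicialComplex W}
    {φ : ∀ n, TupleChain K V n →ₗ[K] TupleChain K W n} (h : IsCarried Δ Φ φ) (hΔ : Δ' ≤ Δ)
    (hΦ : ∀ σ ∈ Δ', Φ σ ≤ Φ' σ) : IsCarried Δ' Φ' φ where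
  zero := h.zero
  mem n x hx := tupleChains_mono (hΦ _ hx) _ (h.mem n x (hΔ hx))
  comm n z hz := h.comm n z (tupleChains_mono hΔ _ hz)

theorem IsCarried.map_mem {Δ : PreAbstractSimplicialComplex V}
    {Φ : Finset V → PreAbstractSimplicialComplex W}
    {φ : ∀ n, TupleChain K V n →ₗ[K] TupleChain K W n} (h : IsCarried Δ Φ φ)
    {Δ' : PreAbstractSimplicialComplex V} (hΔ : Δ' ≤ Δ) {Γ : PreAbstractSimplicialComplex W}
    (hΓ : ∀ σ ∈ Δ', Φ σ ≤ Γ) {n : ℕ} {z : TupleChain K V n} (hz : z ∈ tupleChains K Δ' n) :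
    φ n z ∈ tupleChains K Γ n := by
  rcases n with _ | n
  · exact mem_tupleChains_zero _ _
  · refine map_mem_of_single _ _ (fun x hx => ?_) hz
    have hx := hx.resolve_left (Nat.succ_ne_zero _)
    exact tupleChains_mono (hΓ _ hx) _ (h.mem n x (hΔ hx))

theorem isCarried_id (Δ : PreAbstractSimplicialComplex V)
    {Φ : Finset V → PreAbstractSimplicialComplex V} (h : ∀ σ ∈ Δ, σ ∈ Φ σ) :
    IsCarried Δ Φ fun n => (LinearMap.id : TupleChain K V n →ₗ[K] TupleChain K V n) where
  zero := by
    refine Finsupp.lhom_ext' fun x => LinearMap.ext_ring ?_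
    simp only [LinearMap.comp_apply, Finsupp.lsingle_apply, LinearMap.id_apply,
      Finsupp.lmapDomain_apply, Finsupp.mapDomain_single]
    congr 1
    exact Subsingleton.elim _ _
  mem n x hx := single_mem_tupleChains (Or.inr (h _ hx)) 1
  comm _ _ _ := rfl

/-- The chain map constructed by recursion from an acyclic carrier. -/
noncomputable def carrierMap (K : Type v) [Field K]
    (Φ : Finset V → PreAbstractSimplicialComplex W) :
    ∀ n, TupleChain K V n →ₗ[K] TupleChain K W n
  | 0 => Finsupp.lmapDomain K K fun _ => Fin.elim0
  | n + 1 => Finsupp.linearCombination K fun x =>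
      open Classical in
      -- The value `0` is a default outside the simplices under consideration; on these, exactness
      -- of the carrier supplies a filling.
      if h : ∃ w ∈ tupleChains K (Φ (entries x)) (n + 1), tupleBoundary K W n w =
          carrierMap K Φ n (tupleBoundary K V n (Finsupp.single x 1)) then h.choose else 0

theorem carrierMap_spec {Φ : Finset V → PreAbstractSimplicialComplex W} {n : ℕ}
    {x : Fin (n + 1) → V}
    (h : ∃ w ∈ tupleChains K (Φ (entries x)) (n + 1), tupleBoundary K W n w =
      carrierMap K Φ n (tupleBoundary K V n (Finsupp.single x 1))) :
    carrierMap K Φ (n + 1) (Finsupp.single x 1) ∈ tupleChains K (Φ (entries x)) (n + 1) ∧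
      tupleBoundary K W n (carrierMap K Φ (n + 1) (Finsupp.single x 1)) =
        carrierMap K Φ n (tupleBoundary K V n (Finsupp.single x 1)) := by
  have e : carrierMap K Φ (n + 1) (Finsupp.single x 1) = h.choose := by
    rw [carrierMap, Finsupp.linearCombination_single, one_smul, dif_pos h]
  rw [e]
  exact h.choose_spec

/-- An acyclic carrier carries a chain map. -/
theorem isCarried_carrierMap {Δ : PreAbstractSimplicialComplex V}
    {Φ : Finset V → PreAbstractSimplicialComplex W} (hΦ : MonoCarrier Δ Φ)
    (hex : ∀ σ ∈ Δ, AugExact K (Φ σ)) : IsCarried Δ Φ (carrierMap K Φ) := by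
  have key : ∀ (n : ℕ) (x : Fin (n + 1) → V), entries x ∈ Δ →
      carrierMap K Φ (n + 1) (Finsupp.single x 1) ∈ tupleChains K (Φ (entries x)) (n + 1) ∧
      tupleBoundary K W n (carrierMap K Φ (n + 1) (Finsupp.single x 1)) =
        carrierMap K Φ n (tupleBoundary K V n (Finsupp.single x 1)) := by
    intro n
    induction n with
    | zero => exact fun x hx => carrierMap_spec ((hex _ hx).exists_zero _)
    | succ n ih =>
      intro x hx
      -- Working in the restriction to the vertices of `x` records that all tuples of `∂x` have
      -- entries among those of `x`, so that monotonicity puts their images in `Φ (entries x)`.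
      have hx' : entries x ∈ restrict Δ (entries x : Set V) := mem_restrict.2 ⟨hx, subset_rfl⟩
      have hb := tupleBoundary_mem (single_mem_tupleChains (Or.inr hx') (1 : K))
      refine carrierMap_spec ((hex _ hx).exists_succ ?_ ?_)
      · refine map_mem_of_single _ _ (fun y hy => ?_) hb
        have hy := mem_restrict.1 (hy.resolve_left (Nat.succ_ne_zero _))
        exact tupleChains_mono (hΦ _ hy.1 _ hx (Finset.coe_subset.1 hy.2)) _ (ih y hy.1).1
      · have := map_eq_of_single (f := tupleBoundary K W n ∘ₗ carrierMap K Φ (n + 1))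
          (g := carrierMap K Φ n ∘ₗ tupleBoundary K V n)
          (fun y hy =>
            (ih y (mem_restrict.1 (hy.resolve_left (Nat.succ_ne_zero _))).1).2) hb
        simp only [LinearMap.comp_apply] at this
        rw [this, tupleBoundary_tupleBoundary, map_zero]
  refine ⟨rfl, fun n x hx => (key n x hx).1, fun n z hz => ?_⟩
  exact map_eq_of_single (f := tupleBoundary K W n ∘ₗ carrierMap K Φ (n + 1))
    (g := carrierMap K Φ n ∘ₗ tupleBoundary K V n)
    (fun y hy => (key n y (hy.resolve_left (Nat.succ_ne_zero _))).2) hz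

/-- The chain homotopy constructed by recursion from an acyclic carrier. -/
noncomputable def carrierHomotopy (Φ : Finset V → PreAbstractSimplicialComplex W)
    (φ ψ : ∀ n, TupleChain K V n →ₗ[K] TupleChain K W n) :
    ∀ n, TupleChain K V n →ₗ[K] TupleChain K W (n + 1)
  -- Carried maps agree on the empty tuple, so the homotopy may start at zero.
  | 0 => 0
  | n + 1 => Finsupp.linearCombination K fun x =>
      open Classical in
      if h : ∃ w ∈ tupleChains K (Φ (entries x)) (n + 2), tupleBoundary K W (n + 1) w =
          φ (n + 1) (Finsupp.single x 1) - ψ (n + 1) (Finsupp.single x 1) -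
            carrierHomotopy Φ φ ψ n (tupleBoundary K V n (Finsupp.single x 1))
      then h.choose else 0

theorem carrierHomotopy_spec {Φ : Finset V → PreAbstractSimplicialComplex W}
    {φ ψ : ∀ n, TupleChain K V n →ₗ[K] TupleChain K W n} {n : ℕ} {x : Fin (n + 1) → V}
    (h : ∃ w ∈ tupleChains K (Φ (entries x)) (n + 2), tupleBoundary K W (n + 1) w =
      φ (n + 1) (Finsupp.single x 1) - ψ (n + 1) (Finsupp.single x 1) -
        carrierHomotopy Φ φ ψ n (tupleBoundary K V n (Finsupp.single x 1))) :
    carrierHomotopy Φ φ ψ (n + 1) (Finsupp.single x 1) ∈ tupleChains K (Φ (entries x)) (n + 2) ∧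
      tupleBoundary K W (n + 1) (carrierHomotopy Φ φ ψ (n + 1) (Finsupp.single x 1)) =
        φ (n + 1) (Finsupp.single x 1) - ψ (n + 1) (Finsupp.single x 1) -
          carrierHomotopy Φ φ ψ n (tupleBoundary K V n (Finsupp.single x 1)) := by
  have e : carrierHomotopy Φ φ ψ (n + 1) (Finsupp.single x 1) = h.choose := by
    rw [carrierHomotopy, Finsupp.linearCombination_single, one_smul, dif_pos h]
  rw [e]
  exact h.choose_spec

/-- Two chain maps with a common acyclic carrier are chain homotopic: they differ on cycles by
boundaries. -/
theorem IsCarried.exists_boundary {Δ : PreAbstractSimplicialComplex V}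
    {Φ : Finset V → PreAbstractSimplicialComplex W} (hΦ : MonoCarrier Δ Φ)
    (hex : ∀ σ ∈ Δ, AugExact K (Φ σ)) {φ ψ : ∀ n, TupleChain K V n →ₗ[K] TupleChain K W n}
    (hφ : IsCarried Δ Φ φ) (hψ : IsCarried Δ Φ ψ) {Γ : PreAbstractSimplicialComplex W}
    (hΓ : ∀ σ ∈ Δ, Φ σ ≤ Γ) (n : ℕ) {z : TupleChain K V (n + 1)}
    (hz : z ∈ tupleChains K Δ (n + 1)) (hb : n = 0 ∨ tupleBoundary K V n z = 0) :
    ∃ w ∈ tupleChains K Γ (n + 2),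
      tupleBoundary K W (n + 1) w = φ (n + 1) z - ψ (n + 1) z := by
  have key : ∀ (n : ℕ) (x : Fin (n + 1) → V), entries x ∈ Δ →
      carrierHomotopy Φ φ ψ (n + 1) (Finsupp.single x 1) ∈
        tupleChains K (Φ (entries x)) (n + 2) ∧
      tupleBoundary K W (n + 1) (carrierHomotopy Φ φ ψ (n + 1) (Finsupp.single x 1)) =
        φ (n + 1) (Finsupp.single x 1) - ψ (n + 1) (Finsupp.single x 1) -
          carrierHomotopy Φ φ ψ n (tupleBoundary K V n (Finsupp.single x 1)) := by
    intro n
    induction n with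
    | zero =>
      intro x hx
      have hs := single_mem_tupleChains (Or.inr hx) (1 : K)
      refine carrierHomotopy_spec ((hex _ hx).exists_succ ?_ ?_)
      · exact Submodule.sub_mem _ (Submodule.sub_mem _ (hφ.mem 0 x hx) (hψ.mem 0 x hx))
          (Submodule.zero_mem _)
      · simp only [carrierHomotopy, LinearMap.zero_apply, sub_zero, map_sub]
        rw [hφ.comm 0 _ hs, hψ.comm 0 _ hs, hφ.zero, hψ.zero, sub_self]
    | succ n ih =>
      intro x hx
      have hs := single_mem_tupleChains (Or.inr hx) (1 : K)
      have hx' : entries x ∈ restrict Δ (entries x : Set V) := mem_restrict.2 ⟨hx, subset_rfl⟩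
      have hb := tupleBoundary_mem (single_mem_tupleChains (Or.inr hx') (1 : K))
      refine carrierHomotopy_spec ((hex _ hx).exists_succ ?_ ?_)
      · refine Submodule.sub_mem _ (Submodule.sub_mem _ (hφ.mem _ x hx) (hψ.mem _ x hx)) ?_
        refine map_mem_of_single _ _ (fun y hy => ?_) hb
        have hy := mem_restrict.1 (hy.resolve_left (Nat.succ_ne_zero _))
        exact tupleChains_mono (hΦ _ hy.1 _ hx (Finset.coe_subset.1 hy.2)) _ (ih y hy.1).1
      · have := map_eq_of_single
          (f := tupleBoundary K W (n + 1) ∘ₗ carrierHomotopy Φ φ ψ (n + 1))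
          (g := φ (n + 1) - ψ (n + 1) - carrierHomotopy Φ φ ψ n ∘ₗ tupleBoundary K V n)
          (fun y hy =>
            (ih y (mem_restrict.1 (hy.resolve_left (Nat.succ_ne_zero _))).1).2) hb
        simp only [LinearMap.comp_apply, LinearMap.sub_apply, tupleBoundary_tupleBoundary,
          map_zero, sub_zero] at this
        rw [map_sub, map_sub, this, hφ.comm _ _ hs, hψ.comm _ _ hs, sub_self]
  refine ⟨carrierHomotopy Φ φ ψ (n + 1) z, ?_, ?_⟩
  · refine map_mem_of_single _ _ (fun x hx => ?_) hz
    have hx := hx.resolve_left (Nat.succ_ne_zero _)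
    exact tupleChains_mono (hΓ _ hx) _ (key n x hx).1
  · have h := map_eq_of_single
      (f := tupleBoundary K W (n + 1) ∘ₗ carrierHomotopy Φ φ ψ (n + 1))
      (g := φ (n + 1) - ψ (n + 1) - carrierHomotopy Φ φ ψ n ∘ₗ tupleBoundary K V n)
      (fun y hy => (key n y (hy.resolve_left (Nat.succ_ne_zero _))).2) hz
    -- For `n = 0` the chain need not be a cycle of the augmented complex: the homotopy vanishes on
    -- the empty tuple anyway. This covers unreduced `H₀`.
    have h0 : carrierHomotopy Φ φ ψ n (tupleBoundary K V n z) = 0 := by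
      rcases hb with rfl | hb
      · rfl
      · rw [hb, map_zero]
    simpa only [LinearMap.comp_apply, LinearMap.sub_apply, h0, sub_zero] using h

/-- A complex that is a homology retract of an acyclic complex by means of acyclic carriers is
acyclic. -/
theorem AugExact.of_retract {Δ : PreAbstractSimplicialComplex V}
    {Γ : PreAbstractSimplicialComplex W} (hΓ : AugExact K Γ)
    {Φ : Finset V → PreAbstractSimplicialComplex W} (hΦ : MonoCarrier Δ Φ)
    (hΦex : ∀ σ ∈ Δ, AugExact K (Φ σ)) (hΦΓ : ∀ σ ∈ Δ, Φ σ ≤ Γ)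
    {Ψ : Finset W → PreAbstractSimplicialComplex V} (hΨ : MonoCarrier Γ Ψ)
    (hΨex : ∀ τ ∈ Γ, AugExact K (Ψ τ)) (hΨΔ : ∀ τ ∈ Γ, Ψ τ ≤ Δ)
    {Θ : Finset V → PreAbstractSimplicialComplex V} (hΘ : MonoCarrier Δ Θ)
    (hΘex : ∀ σ ∈ Δ, AugExact K (Θ σ)) (hΘΔ : ∀ σ ∈ Δ, Θ σ ≤ Δ) (hmem : ∀ σ ∈ Δ, σ ∈ Θ σ)
    (hcomp : ∀ σ ∈ Δ, ∀ τ ∈ Φ σ, Ψ τ ≤ Θ σ) (hne : ∃ σ, σ ∈ Δ) : AugExact K Δ := by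
  have hφ := isCarried_carrierMap (K := K) hΦ hΦex
  have hψ := isCarried_carrierMap (K := K) hΨ hΨex
  have hψφ : IsCarried Δ Θ fun n => carrierMap K Ψ n ∘ₗ carrierMap K Φ n := by
    refine ⟨?_, fun n x hx => ?_, fun n z hz => ?_⟩
    · rw [hφ.zero, hψ.zero, ← Finsupp.lmapDomain_comp]
      rfl
    · exact hψ.map_mem (hΦΓ _ hx) (hcomp _ hx) (hφ.mem n x hx)
    · have := hφ.map_mem le_rfl hΦΓ hz
      simp only [LinearMap.comp_apply]
      rw [hψ.comm n _ this, hφ.comm n z hz]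
  refine augExact_iff.2 ⟨fun z => ?_, fun n z hz hb => ?_⟩
  · obtain ⟨σ, hσ⟩ := hne
    obtain ⟨w, hw, rfl⟩ := (hΘex σ hσ).exists_zero z
    exact ⟨w, tupleChains_mono (hΘΔ σ hσ) _ hw, rfl⟩
  · have hφz := hφ.map_mem le_rfl hΦΓ hz
    obtain ⟨w, hw, hwz⟩ := hΓ.exists_succ hφz (by rw [hφ.comm n z hz, hb, map_zero])
    obtain ⟨t, ht, htz⟩ := hψφ.exists_boundary hΘ hΘex (isCarried_id Δ hmem) hΘΔ n hz (Or.inr hb)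
    simp only [LinearMap.comp_apply, LinearMap.id_apply] at htz
    -- With `∂w = φ z` and `∂t = ψ φ z - z`, the chain `ψ w - t` has boundary `z`.
    refine ⟨carrierMap K Ψ (n + 2) w - t, Submodule.sub_mem _ ?_ ht, ?_⟩
    · exact hψ.map_mem le_rfl hΨΔ hw
    · rw [map_sub, hψ.comm _ _ hw, hwz, htz, sub_sub_cancel]

end Carriers
/-! ### The nerve theorem for covers closed under intersections -/

section Nerve

variable {K : Type v} [Field K] {X : Type*}

theorem mem_nerve {𝓑 : Set (Set X)} {s : Finset (Set X)} :
    s ∈ nerve 𝓑 ↔ s.Nonempty ∧ (s : Set (Set X)) ⊆ 𝓑 ∧ (⋂₀ (s : Set (Set X))).Nonempty :=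
  Iff.rfl

/-- The full simplex on the vertices of a simplex is acyclic. -/
theorem augExact_restrict_simplex {Δ : PreAbstractSimplicialComplex X} {σ : Finset X}
    (hσ : σ ∈ Δ) : AugExact K (restrict Δ (σ : Set X)) := by
  classical
  obtain ⟨v, hv⟩ := nonempty_of_mem hσ
  have key : ∀ τ ⊆ σ, τ.Nonempty → τ ∈ restrict Δ (σ : Set X) := fun τ h hτ =>
    mem_restrict.2 ⟨mem_of_subset hσ h hτ, Finset.coe_subset.2 h⟩
  refine augExact_of_cone v (key _ (Finset.singleton_subset_iff.2 hv)
    (Finset.singleton_nonempty v)) fun τ hτ => key _ ?_ (Finset.insert_nonempty _ _)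
  exact Finset.insert_subset hv (Finset.coe_subset.1 hτ.2)

/-- The order complex of a family of sets. -/
def orderComplex (𝓑 : Set (Set X)) : PreAbstractSimplicialComplex (Set X) where
  faces := {s | s.Nonempty ∧ (s : Set (Set X)) ⊆ 𝓑 ∧ IsChain (· ⊆ ·) (s : Set (Set X))}
  isRelLowerSet_faces := by
    rintro s ⟨hs, hs𝓑, hc⟩
    exact ⟨hs, fun t ht hne => ⟨hne, (Finset.coe_subset.2 ht).trans hs𝓑,
      IsChain.mono (Finset.coe_subset.2 ht) hc⟩⟩

theorem mem_orderComplex {𝓑 : Set (Set X)} {s : Finset (Set X)} :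
    s ∈ orderComplex 𝓑 ↔
      s.Nonempty ∧ (s : Set (Set X)) ⊆ 𝓑 ∧ IsChain (· ⊆ ·) (s : Set (Set X)) :=
  Iff.rfl

/-- The smallest member of a finite chain is nonempty and lies in all the others. -/
theorem orderComplex_le_nerve {𝓑 : Set (Set X)} (h : ∀ B ∈ 𝓑, B.Nonempty) :
    orderComplex 𝓑 ≤ nerve 𝓑 := by
  intro s hs
  obtain ⟨hne, hs𝓑, hc⟩ := mem_orderComplex.1 hs
  refine mem_nerve.2 ⟨hne, hs𝓑, ?_⟩
  obtain ⟨m, hm⟩ := s.exists_minimal hne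
  refine (h m (hs𝓑 hm.1)).mono (Set.subset_sInter fun B hB => ?_)
  rcases hc.total hm.1 hB with h | h
  · exact h
  · exact hm.2 hB h

/-- Adding to a chain a set comparable with all its members leaves a chain, so the complex is a cone
with apex `A`. -/
theorem augExact_restrict_orderComplex {𝓑 𝓐 : Set (Set X)} {A : Set X} (hA : A ∈ 𝓑)
    (hA' : A ∈ 𝓐) (h : (∀ B ∈ 𝓐, A ⊆ B) ∨ (∀ B ∈ 𝓐, B ⊆ A)) :
    AugExact K (restrict (orderComplex 𝓑) 𝓐) := by
  classical
  refine augExact_of_cone A ?_ fun s hs => ?_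
  · refine mem_restrict.2 ⟨mem_orderComplex.2 ⟨Finset.singleton_nonempty A, ?_, ?_⟩, ?_⟩ <;>
      simp [hA, hA']
  · obtain ⟨⟨-, hs𝓑, hc⟩, hs𝓐⟩ := hs
    refine mem_restrict.2 ⟨mem_orderComplex.2 ⟨Finset.insert_nonempty _ _, ?_, ?_⟩, ?_⟩
    · rw [Finset.coe_insert]
      exact Set.insert_subset hA hs𝓑
    · rw [Finset.coe_insert]
      refine hc.insert fun B hB _ => ?_
      exact h.imp (fun h => h B (hs𝓐 hB)) (fun h => h B (hs𝓐 hB))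
    · rw [Finset.coe_insert]
      exact Set.insert_subset hA' hs𝓐

/-- If the nerve of a family of sets that is closed under nonempty intersections is acyclic,
then so is its order complex. -/
theorem augExact_orderComplex {𝓑 : Set (Set X)} (hne : ∀ B ∈ 𝓑, B.Nonempty)
    (hinter : ∀ I ⊆ 𝓑, I.Nonempty → (⋂₀ I).Nonempty → ⋂₀ I ∈ 𝓑)
    (h𝓑 : 𝓑.Nonempty) (hN : AugExact K (nerve 𝓑)) : AugExact K (orderComplex 𝓑) := by
  have hle := orderComplex_le_nerve hne
  have hmono : MonoCarrier (nerve 𝓑) fun s => restrict (orderComplex 𝓑) {B | ⋂₀ ↑s ⊆ B} :=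
    fun s _ t _ hst => restrict_mono _ fun B hB =>
      (Set.sInter_subset_sInter (Finset.coe_subset.2 hst)).trans hB
  have hex : ∀ s ∈ nerve 𝓑, AugExact K (restrict (orderComplex 𝓑) {B | ⋂₀ ↑s ⊆ B}) :=
    fun s hs => augExact_restrict_orderComplex (A := ⋂₀ ↑s)
      (hinter _ hs.2.1 (Finset.coe_nonempty.2 hs.1) hs.2.2) (Set.mem_ofPred.2 subset_rfl)
      (Or.inl fun B hB => hB)
  -- A chain goes to the full simplex on its members; a nerve simplex `s` goes back to the chains of
  -- members containing `⋂₀ s`, a cone with apex `⋂₀ s`. Larger `s` have smaller intersections, so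
  -- the return carrier is monotone and also serves as `Θ`.
  refine hN.of_retract (Φ := fun s => restrict (nerve 𝓑) (s : Set (Set X)))
    (fun s _ t _ hst => restrict_mono _ (Finset.coe_subset.2 hst))
    (fun s hs => augExact_restrict_simplex (hle hs)) (fun s _ => restrict_le _ _)
    hmono hex (fun s _ => restrict_le _ _)
    (fun s hs t ht => hmono s (hle hs) t (hle ht)) (fun s hs => hex s (hle hs))
    (fun s _ => restrict_le _ _) (fun s hs => mem_restrict.2 ⟨hs, fun B hB =>
      Set.sInter_subset_of_mem hB⟩)
    (fun s hs t ht => hmono t ht.1 s (hle hs) (Finset.coe_subset.1 ht.2)) ?_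
  obtain ⟨B, hB⟩ := h𝓑
  exact ⟨{B}, mem_orderComplex.2 ⟨Finset.singleton_nonempty B, by simpa using hB, by simp⟩⟩

/-- The simplices of `Δ` that are contained in a member of the family `𝓑`. -/
def coverSubcomplex (Δ : PreAbstractSimplicialComplex X) (𝓑 : Set (Set X)) :
    PreAbstractSimplicialComplex X where
  faces := {σ | σ ∈ Δ ∧ ∃ B ∈ 𝓑, (σ : Set X) ⊆ B}
  isRelLowerSet_faces := by
    rintro σ ⟨hσ, B, hB, hσB⟩
    exact ⟨nonempty_of_mem hσ, fun τ hτ hne =>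
      ⟨mem_of_subset hσ hτ hne, B, hB, (Finset.coe_subset.2 hτ).trans hσB⟩⟩

theorem mem_coverSubcomplex {Δ : PreAbstractSimplicialComplex X} {𝓑 : Set (Set X)}
    {σ : Finset X} : σ ∈ coverSubcomplex Δ 𝓑 ↔ σ ∈ Δ ∧ ∃ B ∈ 𝓑, (σ : Set X) ⊆ B :=
  Iff.rfl

theorem exists_forall_subset_of_mem_orderComplex {𝓑 : Set (Set X)} {s : Finset (Set X)}
    (hs : s ∈ orderComplex 𝓑) : ∃ M ∈ s, ∀ B ∈ s, B ⊆ M := by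
  obtain ⟨hne, -, hc⟩ := mem_orderComplex.1 hs
  obtain ⟨m, hm⟩ := s.exists_maximal hne
  refine ⟨m, hm.1, fun B hB => ?_⟩
  rcases hc.total hm.1 hB with h | h
  · exact hm.2 hB h
  · exact h

/-- A nerve theorem: if a family of sets is closed under nonempty intersections, its nerve is
acyclic, and `Δ` is acyclic on each of its sets, then their union in `Δ` is acyclic. -/
theorem augExact_coverSubcomplex {Δ : PreAbstractSimplicialComplex X} {𝓑 : Set (Set X)}
    (hne : ∀ B ∈ 𝓑, B.Nonempty)
    (hinter : ∀ I ⊆ 𝓑, I.Nonempty → (⋂₀ I).Nonempty → ⋂₀ I ∈ 𝓑)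
    (h𝓑 : 𝓑.Nonempty) (hN : AugExact K (nerve 𝓑)) (hΔ : ∀ B ∈ 𝓑, AugExact K (restrict Δ B))
    (hD : ∃ σ, σ ∈ coverSubcomplex Δ 𝓑) : AugExact K (coverSubcomplex Δ 𝓑) := by
  have hO := augExact_orderComplex hne hinter h𝓑 hN
  -- On the simplices of the union, closure under intersections makes the hull the smallest member
  -- of `𝓑` containing `σ`.
  let hull : Finset X → Set X := fun σ => ⋂₀ {B | B ∈ 𝓑 ∧ (σ : Set X) ⊆ B}
  have hull_mono : ∀ σ τ : Finset X, σ ⊆ τ → hull σ ⊆ hull τ := fun σ τ h =>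
    Set.sInter_subset_sInter fun B hB => ⟨hB.1, (Finset.coe_subset.2 h).trans hB.2⟩
  have subset_hull : ∀ σ : Finset X, (σ : Set X) ⊆ hull σ := fun σ =>
    Set.subset_sInter fun B hB => hB.2
  have hull_mem : ∀ σ ∈ coverSubcomplex Δ 𝓑, hull σ ∈ 𝓑 := by
    rintro σ ⟨hσ, B, hB, hσB⟩
    exact hinter _ (fun _ h => h.1) ⟨B, hB, hσB⟩
      ((Finset.coe_nonempty.2 (nonempty_of_mem hσ)).mono (subset_hull σ))
  have restrict_le_cover : ∀ B ∈ 𝓑, restrict Δ B ≤ coverSubcomplex Δ 𝓑 := fun B hB σ hσ =>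
    ⟨hσ.1, B, hB, hσ.2⟩
  have hunion : ∀ s ∈ orderComplex 𝓑, ⋃₀ (s : Set (Set X)) ∈ 𝓑 := by
    intro s hs
    obtain ⟨M, hM, hMs⟩ := exists_forall_subset_of_mem_orderComplex hs
    have : ⋃₀ (s : Set (Set X)) = M :=
      (Set.sUnion_subset hMs).antisymm (Set.subset_sUnion_of_mem (Finset.mem_coe.2 hM))
    rw [this]
    exact hs.2.1 hM
  -- A simplex goes to the chains below its hull, a cone with apex the hull; a chain goes to `Δ` on
  -- its largest member, written as a union so that monotonicity is visible. The round trip stays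
  -- inside the hull.
  refine hO.of_retract (Φ := fun σ => restrict (orderComplex 𝓑) (Set.Iic (hull σ)))
    (fun σ _ τ _ h => restrict_mono _ (Set.Iic_subset_Iic.2 (hull_mono σ τ h)))
    (fun σ hσ => augExact_restrict_orderComplex (hull_mem σ hσ) (Set.mem_Iic.2 le_rfl)
      (Or.inr fun B hB => hB)) (fun σ _ => restrict_le _ _)
    (Ψ := fun s => restrict Δ (⋃₀ (s : Set (Set X))))
    (fun s _ t _ h => restrict_mono _ (Set.sUnion_subset_sUnion (Finset.coe_subset.2 h)))
    (fun s hs => hΔ _ (hunion s hs)) (fun s hs => restrict_le_cover _ (hunion s hs))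
    (Θ := fun σ => restrict Δ (hull σ))
    (fun σ _ τ _ h => restrict_mono _ (hull_mono σ τ h)) (fun σ hσ => hΔ _ (hull_mem σ hσ))
    (fun σ hσ => restrict_le_cover _ (hull_mem σ hσ))
    (fun σ hσ => mem_restrict.2 ⟨hσ.1, subset_hull σ⟩)
    (fun σ hσ s hs => restrict_mono _ (Set.sUnion_subset fun B hB => hs.2 hB)) hD

end Nerve
/-! ### Interleavings from acyclic carriers -/

section HomologyMaps

variable {K : Type v} [Field K] {V : Type u}

theorem mem_chains_iff {Δ : PreAbstractSimplicialComplex V} {n : ℕ} {z : Chain K V n} :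
    z ∈ chains K Δ n ↔ z ∈ tupleChains K Δ (n + 1) := by
  have : chains K Δ n = tupleChains K Δ (n + 1) := by
    simp [chains, tupleChains]
  rw [this]

theorem mem_cycles_iff {Δ : PreAbstractSimplicialComplex V} {n : ℕ} {z : Chain K V n} :
    z ∈ cycles K Δ n ↔
      z ∈ tupleChains K Δ (n + 1) ∧ (n = 0 ∨ tupleBoundary K V n z = 0) := by
  rcases n with _ | n
  · simp [cycles, mem_chains_iff]
  · rw [cycles, Submodule.mem_inf, mem_chains_iff, LinearMap.mem_ker, or_iff_right n.succ_ne_zero]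
    rfl

theorem mem_boundaries_iff {Δ : PreAbstractSimplicialComplex V} {n : ℕ} {z : Chain K V n} :
    z ∈ boundaries K Δ n ↔ ∃ w ∈ tupleChains K Δ (n + 2), tupleBoundary K V (n + 1) w = z := by
  rw [boundaries, Submodule.mem_map]
  simp only [mem_chains_iff]
  rfl

theorem tupleBoundary_zero_apply (z : Chain K V 0) :
    tupleBoundary K V 0 z = Finsupp.single Fin.elim0 (augmentation K V z) := by
  have : tupleBoundary K V 0 = Finsupp.lsingle Fin.elim0 ∘ₗ augmentation K V := by
    refine Finsupp.lhom_ext' fun x => LinearMap.ext_ring ?_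
    simp only [LinearMap.comp_apply, Finsupp.lsingle_apply, tupleBoundary_single]
    simp [augmentation, Subsingleton.elim _ (Fin.elim0 : Fin 0 → V)]
  exact LinearMap.congr_fun this z

/-- A nonempty acyclic complex has an exact augmented chain complex. -/
theorem Acyclic.augExact {Δ : PreAbstractSimplicialComplex V} (h : Acyclic K Δ) {v : V}
    (hv : {v} ∈ Δ) : AugExact K Δ := by
  refine augExact_iff.2 ⟨fun z => ⟨coneOp K v 0 z, ?_, tupleBoundary_coneOp_zero K v z⟩,
    fun n z hz hb => mem_boundaries_iff.1 (h n ?_)⟩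
  · refine map_mem_of_single (Δ := Δ) _ _ (fun x _ => ?_) (mem_tupleChains_zero Δ z)
    rw [coneOp_single]
    refine single_mem_tupleChains (Or.inr ?_) _
    have : entries (Fin.cons v x : Fin 1 → V) = {v} := by
      ext w
      simp [entries, Fin.range_cons]
    rwa [this]
  · rcases n with _ | n
    · refine Submodule.mem_inf.2 ⟨mem_chains_iff.2 hz, LinearMap.mem_ker.2 ?_⟩
      rwa [tupleBoundary_zero_apply, Finsupp.single_eq_zero] at hb
    · exact Submodule.mem_inf.2 ⟨mem_chains_iff.2 hz, LinearMap.mem_ker.2 hb⟩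

theorem AugExact.acyclic {Δ : PreAbstractSimplicialComplex V} (h : AugExact K Δ) :
    Acyclic K Δ := by
  intro n z hz
  obtain ⟨hz, hb⟩ : z ∈ tupleChains K Δ (n + 1) ∧ tupleBoundary K V n z = 0 := by
    rcases n with _ | n
    · obtain ⟨hz, hb⟩ := Submodule.mem_inf.1 hz
      refine ⟨mem_chains_iff.1 hz, ?_⟩
      rw [tupleBoundary_zero_apply, LinearMap.mem_ker.1 hb, Finsupp.single_zero]
    · obtain ⟨hz, hb⟩ := Submodule.mem_inf.1 hz
      exact ⟨mem_chains_iff.1 hz, hb⟩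
  exact mem_boundaries_iff.2 (h.exists_succ hz hb)

/-- The homology class of a cycle. -/
noncomputable def homologyClass (Δ : PreAbstractSimplicialComplex V) (n : ℕ) (z : Chain K V n)
    (hz : z ∈ cycles K Δ n) : Homology K Δ n :=
  Submodule.Quotient.mk ⟨z, hz⟩

theorem homologyClass_eq_iff {Δ : PreAbstractSimplicialComplex V} {n : ℕ} {z w : Chain K V n}
    {hz : z ∈ cycles K Δ n} {hw : w ∈ cycles K Δ n} :
    homologyClass Δ n z hz = homologyClass Δ n w hw ↔ z - w ∈ boundaries K Δ n :=
  Submodule.Quotient.eq _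

theorem homology_hom_ext {Δ : PreAbstractSimplicialComplex V} {n : ℕ} {M : Type*}
    [AddCommGroup M] [Module K M] {f g : Homology K Δ n →ₗ[K] M}
    (h : ∀ z hz, f (homologyClass Δ n z hz) = g (homologyClass Δ n z hz)) : f = g := by
  refine LinearMap.ext fun a => ?_
  obtain ⟨⟨z, hz⟩, rfl⟩ := Submodule.Quotient.mk_surjective _ a
  exact h z hz

theorem homologyMap_class {Δ Δ' : PreAbstractSimplicialComplex V} (h : Δ ≤ Δ') (n : ℕ)
    (z : Chain K V n) (hz : z ∈ cycles K Δ n) :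
    homologyMap K h n (homologyClass Δ n z hz) =
      homologyClass Δ' n z (cycles_mono K h n hz) :=
  rfl

theorem IsCarried.map_cycles {Δ Γ : PreAbstractSimplicialComplex V}
    {Φ : Finset V → PreAbstractSimplicialComplex V}
    {φ : ∀ n, TupleChain K V n →ₗ[K] TupleChain K V n} (h : IsCarried Δ Φ φ)
    (hΓ : ∀ σ ∈ Δ, Φ σ ≤ Γ) {n : ℕ} {z : Chain K V n} (hz : z ∈ cycles K Δ n) :
    φ (n + 1) z ∈ cycles K Γ n := by
  obtain ⟨hz, hb⟩ := mem_cycles_iff.1 hz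
  refine mem_cycles_iff.2 ⟨h.map_mem le_rfl hΓ hz, hb.imp_right fun hb => ?_⟩
  rw [h.comm n z hz, hb, map_zero]

theorem IsCarried.map_boundaries {Δ Γ : PreAbstractSimplicialComplex V}
    {Φ : Finset V → PreAbstractSimplicialComplex V}
    {φ : ∀ n, TupleChain K V n →ₗ[K] TupleChain K V n} (h : IsCarried Δ Φ φ)
    (hΓ : ∀ σ ∈ Δ, Φ σ ≤ Γ) {n : ℕ} {z : Chain K V n} (hz : z ∈ boundaries K Δ n) :
    φ (n + 1) z ∈ boundaries K Γ n := by
  obtain ⟨w, hw, rfl⟩ := mem_boundaries_iff.1 hz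
  exact mem_boundaries_iff.2 ⟨φ (n + 2) w, h.map_mem le_rfl hΓ hw, h.comm _ w hw⟩

/-- The map on homology induced by a carried chain map. -/
noncomputable def IsCarried.homologyMap {Δ Γ : PreAbstractSimplicialComplex V}
    {Φ : Finset V → PreAbstractSimplicialComplex V}
    {φ : ∀ n, TupleChain K V n →ₗ[K] TupleChain K V n} (h : IsCarried Δ Φ φ)
    (hΓ : ∀ σ ∈ Δ, Φ σ ≤ Γ) (n : ℕ) : Homology K Δ n →ₗ[K] Homology K Γ n :=
  Submodule.mapQ _ _ ((φ (n + 1)).restrict fun _ hz => h.map_cycles hΓ hz)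
    fun _ hz => h.map_boundaries hΓ hz

theorem IsCarried.homologyMap_class {Δ Γ : PreAbstractSimplicialComplex V}
    {Φ : Finset V → PreAbstractSimplicialComplex V}
    {φ : ∀ n, TupleChain K V n →ₗ[K] TupleChain K V n} (h : IsCarried Δ Φ φ)
    (hΓ : ∀ σ ∈ Δ, Φ σ ≤ Γ) (n : ℕ) (z : Chain K V n) (hz : z ∈ cycles K Δ n) :
    h.homologyMap hΓ n (homologyClass Δ n z hz) =
      homologyClass Γ n (φ (n + 1) z) (h.map_cycles hΓ hz) :=
  rfl

/-- Chain maps with a common acyclic carrier agree on homology classes. -/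
theorem IsCarried.homologyClass_eq {Δ Γ : PreAbstractSimplicialComplex V}
    {Φ : Finset V → PreAbstractSimplicialComplex V} (hΦ : MonoCarrier Δ Φ)
    (hex : ∀ σ ∈ Δ, AugExact K (Φ σ)) {φ ψ : ∀ n, TupleChain K V n →ₗ[K] TupleChain K V n}
    (hφ : IsCarried Δ Φ φ) (hψ : IsCarried Δ Φ ψ) (hΓ : ∀ σ ∈ Δ, Φ σ ≤ Γ) {n : ℕ}
    {z : Chain K V n} (hz : z ∈ cycles K Δ n) {h₁ h₂} :
    homologyClass Γ n (φ (n + 1) z) h₁ = homologyClass Γ n (ψ (n + 1) z) h₂ := by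
  obtain ⟨hz, hb⟩ := mem_cycles_iff.1 hz
  exact homologyClass_eq_iff.2
    (mem_boundaries_iff.2 (hφ.exists_boundary hΦ hex hψ hΓ n hz hb))

end HomologyMaps

/-- A family of acyclic carriers that goes back from a filtration to a subfiltration yields an
interleaving. -/
theorem interleaved_of_carriers {K : Type v} [Field K] {X : Type u}
    {A B : ℝ≥0 →o PreAbstractSimplicialComplex X} (hAB : ∀ r, A r ≤ B r) {T : Set ℝ≥0}
    {α : ℝ≥0 →o ℝ≥0} (hα : ∀ t ∈ T, t ≤ α t)
    (Φ Ψ : ℝ≥0 → Finset X → PreAbstractSimplicialComplex X)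
    (hΦ : ∀ t ∈ T, MonoCarrier (B t) (Φ t)) (hΦex : ∀ t ∈ T, ∀ σ ∈ B t, AugExact K (Φ t σ))
    (hΦA : ∀ t ∈ T, ∀ σ ∈ B t, Φ t σ ≤ A (α t))
    (hΦΦ : ∀ s ∈ T, ∀ t ∈ T, s ≤ t → ∀ σ ∈ B s, Φ s σ ≤ Φ t σ)
    (hmem : ∀ t ∈ T, ∀ σ ∈ A t, σ ∈ Φ t σ)
    (hΨ : ∀ t ∈ T, MonoCarrier (B t) (Ψ t)) (hΨex : ∀ t ∈ T, ∀ σ ∈ B t, AugExact K (Ψ t σ))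
    (hΨB : ∀ t ∈ T, ∀ σ ∈ B t, Ψ t σ ≤ B (α t))
    (hΦΨ : ∀ t ∈ T, ∀ σ ∈ B t, Φ t σ ≤ Ψ t σ) (hmem' : ∀ t ∈ T, ∀ σ ∈ B t, σ ∈ Ψ t σ)
    (k : ℕ) :
    Interleaved (persistentHomology K A k) (persistentHomology K B k) Set.univ T
      OrderHom.id α := by
  have hc : ∀ t ∈ T, IsCarried (B t) (Φ t) (carrierMap K (Φ t)) := fun t ht =>
    isCarried_carrierMap (hΦ t ht) (hΦex t ht)
  refine ⟨⟨fun s => ModuleCat.ofHom (homologyMap K (hAB s) k), fun s t h => ?_⟩,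
    ⟨fun t => ModuleCat.ofHom ((hc t t.2).homologyMap (hΦA t t.2) k), fun s t h => ?_⟩,
    fun s hs => ⟨hα s hs, ?_⟩, fun t ht => ⟨hα t t.2, ?_⟩⟩
  · refine ModuleCat.hom_ext (homology_hom_ext fun z hz => ?_)
    rfl
  · refine ModuleCat.hom_ext (homology_hom_ext fun z hz => ?_)
    -- On `B s`, the chain maps for `s` and for `t` are both carried by `Φ t`.
    exact IsCarried.homologyClass_eq (fun σ hσ τ hτ => hΦ t t.2 σ (B.monotone h hσ) τ
      (B.monotone h hτ)) (fun σ hσ => hΦex t t.2 σ (B.monotone h hσ))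
      ((hc s s.2).mono le_rfl (hΦΦ s s.2 t t.2 h))
      ((hc t t.2).mono (B.monotone h) fun _ _ => le_rfl)
      (fun σ hσ => hΦA t t.2 σ (B.monotone h hσ)) hz
  · refine ModuleCat.hom_ext (homology_hom_ext fun z hz => ?_)
    -- On the subfiltration `A` the identity is itself carried by `Φ`.
    exact IsCarried.homologyClass_eq (fun σ hσ τ hτ => hΦ s hs σ (hAB _ hσ) τ (hAB _ hτ))
      (fun σ hσ => hΦex s hs σ (hAB _ hσ)) ((hc s hs).mono (hAB s) fun _ _ => le_rfl)
      (isCarried_id _ (hmem s hs)) (fun σ hσ => hΦA s hs σ (hAB _ hσ)) hz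
  · refine ModuleCat.hom_ext (homology_hom_ext fun z hz => ?_)
    -- On all of `B` the larger carrier `Ψ` is needed to carry the identity.
    exact IsCarried.homologyClass_eq (hΨ t t.2) (hΨex t t.2)
      ((hc t t.2).mono le_rfl (hΦΨ t t.2)) (isCarried_id _ (hmem' t t.2)) (hΨB t t.2) hz

/-! ### Carriers for Vietoris–Rips complexes -/

namespace Dissimilarity

variable {X : Type u} (d : Dissimilarity X)

theorem diam_le_iff {σ : Finset X} {r : ℝ≥0} :
    d.diam σ ≤ r ↔ ∀ x ∈ σ, ∀ y ∈ σ, d.dist x y ≤ r := by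
  simp only [diam, Finset.sup_le_iff, Finset.mem_product, Prod.forall]
  exact ⟨fun h x hx y hy => h x y ⟨hx, hy⟩, fun h x y hxy => h x hxy.1 y hxy.2⟩

theorem dist_le_diam {σ : Finset X} {x y : X} (hx : x ∈ σ) (hy : y ∈ σ) :
    d.dist x y ≤ d.diam σ :=
  d.diam_le_iff.1 le_rfl x hx y hy

theorem mem_rips {σ : Finset X} {r : ℝ≥0} : σ ∈ d.rips r ↔ σ.Nonempty ∧ d.diam σ ≤ r :=
  Iff.rfl

theorem coverRips_le_rips (U : Set (Set X)) (r : ℝ≥0) : d.coverRips U r ≤ d.rips r :=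
  fun _ h => h.1

theorem coverRips_eq_rips {U : Set (Set X)} {r : ℝ≥0} (hr : r ∈ d.regime₁ U) :
    d.coverRips U r = d.rips r :=
  le_antisymm (d.coverRips_le_rips U r) fun σ hσ => ⟨hσ, hr σ hσ.1 hσ.2⟩

theorem subset_witnessUnion (σ : Finset X) : (σ : Set X) ⊆ d.witnessUnion σ := by
  intro x hx
  refine ⟨{x}, Finset.singleton_subset_iff.2 hx, Finset.singleton_nonempty x, fun y hy => ?_⟩
  rw [Finset.mem_singleton.1 hy, d.dist_self]
  exact zero_le

theorem witnessUnion_mono {σ τ : Finset X} (h : σ ⊆ τ) :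
    d.witnessUnion σ ⊆ d.witnessUnion τ :=
  fun _ ⟨S, hS, hne, hy⟩ => ⟨S, hS.trans h, hne, hy⟩

theorem exists_dist_le_of_mem_witnessUnion {σ : Finset X} {y : X} (hy : y ∈ d.witnessUnion σ) :
    ∃ x ∈ σ, d.dist y x ≤ d.diam σ := by
  obtain ⟨S, hS, ⟨x, hx⟩, hy⟩ := hy
  exact ⟨x, hS hx, (hy x hx).trans (d.diam_mono hS)⟩

variable {d}

theorem Triangle.dist_le_two_mul (hd : d.Triangle) {σ : Finset X} {y w : X}
    (hy : y ∈ d.witnessUnion σ) (hw : w ∈ d.witness σ) : d.dist y w ≤ 2 * d.diam σ := by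
  obtain ⟨x, hx, hyx⟩ := d.exists_dist_le_of_mem_witnessUnion hy
  rw [two_mul]
  refine (hd y x w).trans (add_le_add hyx ?_)
  rw [d.dist_comm]
  exact hw x hx

theorem Triangle.dist_le_three_mul (hd : d.Triangle) {σ : Finset X} {y w : X}
    (hy : y ∈ d.witnessUnion σ) (hw : w ∈ d.witnessUnion σ) :
    d.dist y w ≤ 3 * d.diam σ := by
  obtain ⟨x, hx, hyx⟩ := d.exists_dist_le_of_mem_witnessUnion hy
  obtain ⟨z, hz, hwz⟩ := d.exists_dist_le_of_mem_witnessUnion hw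
  calc d.dist y w ≤ d.dist y x + d.dist x w := hd _ _ _
    _ ≤ d.dist y x + (d.dist x z + d.dist z w) := by gcongr; exact hd _ _ _
    _ ≤ d.diam σ + (d.diam σ + d.diam σ) := by
        rw [d.dist_comm z w]
        exact add_le_add hyx (add_le_add (d.dist_le_diam hx hz) hwz)
    _ = 3 * d.diam σ := by ring

variable (d)

/-- The part of a Vietoris–Rips complex on the points of `A` is a cone if some point of `A` is
close to all the others. -/
theorem augExact_restrict_rips (K : Type v) [Field K] {ρ : ℝ≥0} {A : Set X} {w : X} (hw : w ∈ A)
    (h : ∀ y ∈ A, d.dist y w ≤ ρ) : AugExact K (restrict (d.rips ρ) A) := by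
  classical
  refine augExact_of_cone w ?_ fun σ hσ => ?_
  · refine mem_restrict.2 ⟨d.mem_rips.2 ⟨Finset.singleton_nonempty w, ?_⟩, by simpa using hw⟩
    refine d.diam_le_iff.2 fun x hx y hy => ?_
    rw [Finset.mem_singleton.1 hx, Finset.mem_singleton.1 hy]
    exact h w hw
  · refine mem_restrict.2 ⟨d.mem_rips.2 ⟨Finset.insert_nonempty _ _, ?_⟩, ?_⟩
    · refine d.diam_le_iff.2 fun x hx y hy => ?_
      have hA : ∀ z ∈ σ, z ∈ A := fun z hz => hσ.2 hz
      rcases Finset.mem_insert.1 hx with rfl | hx' <;>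
        rcases Finset.mem_insert.1 hy with rfl | hy'
      · exact h _ hw
      · rw [d.dist_comm]
        exact h y (hA y hy')
      · exact h x (hA x hx')
      · exact (d.dist_le_diam hx' hy').trans hσ.1.2
    · rw [Finset.coe_insert]
      exact Set.insert_subset hw hσ.2

/-- The vertex set of the carrier of `σ`. -/
def carrierSet (c : ℝ≥0) (σ : Finset X) : Set X := {y | y ∈ σ ∨ c ≠ 1 ∧ y ∈ d.witnessUnion σ}

/-- The carrier of `σ` in the Vietoris–Rips cover complex, with diameters allowed to grow by the
factor `c`. -/
noncomputable def carrier (U : Set (Set X)) (c : ℝ≥0) (σ : Finset X) :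
    PreAbstractSimplicialComplex X :=
  coverSubcomplex (restrict (d.rips (c * d.diam σ)) (d.carrierSet c σ)) U

variable {d}

theorem mem_carrier {U : Set (Set X)} {c : ℝ≥0} {σ τ : Finset X} :
    τ ∈ d.carrier U c σ ↔ ((τ.Nonempty ∧ d.diam τ ≤ c * d.diam σ) ∧
      (τ : Set X) ⊆ d.carrierSet c σ) ∧ ∃ A ∈ U, (τ : Set X) ⊆ A :=
  Iff.rfl

/-- The condition `c ≠ 1` acts as a switch: the first regime uses `σ` alone, the others its witness
union, within one family that is monotone in `c ≥ 1`. -/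
theorem carrierSet_one (σ : Finset X) : d.carrierSet 1 σ = σ := by
  ext
  simp [carrierSet]

theorem carrierSet_of_ne_one {c : ℝ≥0} (hc : c ≠ 1) (σ : Finset X) :
    d.carrierSet c σ = d.witnessUnion σ := by
  ext y
  exact ⟨fun h => h.elim (fun h => d.subset_witnessUnion σ h) (fun h => h.2),
    fun h => Or.inr ⟨hc, h⟩⟩

/-- The bound `1 ≤ c` ensures that `c' = 1` forces `c = 1`, so vertex sets never shrink. Allowing
the cover to change lets the same lemma compare with the trivial cover. -/
theorem carrier_mono {U U' : Set (Set X)} (hU : ∀ A ∈ U, ∃ A' ∈ U', A ⊆ A') {c c' : ℝ≥0}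
    (hc : 1 ≤ c) (hcc : c ≤ c') {σ τ : Finset X} (h : σ ⊆ τ) :
    d.carrier U c σ ≤ d.carrier U' c' τ := by
  rintro ρ ⟨⟨⟨hne, hρ⟩, hρσ⟩, A, hA, hρA⟩
  obtain ⟨A', hA', hAA'⟩ := hU A hA
  refine mem_carrier.2 ⟨⟨⟨hne, hρ.trans (mul_le_mul' hcc (d.diam_mono h))⟩,
    hρσ.trans ?_⟩, A', hA', hρA.trans hAA'⟩
  rintro y (hy | ⟨hy1, hy⟩)
  · exact Or.inl (h hy)
  · exact Or.inr ⟨fun h1 => hy1 (le_antisymm (hcc.trans h1.le) hc), d.witnessUnion_mono h hy⟩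

theorem mem_carrier_self {U : Set (Set X)} {c : ℝ≥0} (hc : 1 ≤ c) {σ : Finset X}
    (hσ : σ.Nonempty) (hU : ∃ A ∈ U, (σ : Set X) ⊆ A) : σ ∈ d.carrier U c σ :=
  mem_carrier.2 ⟨⟨⟨hσ, le_mul_of_one_le_left' hc⟩, fun _ hy => Or.inl hy⟩, hU⟩

theorem carrier_le_coverRips {U : Set (Set X)} {c r : ℝ≥0} {σ : Finset X} (h : d.diam σ ≤ r) :
    d.carrier U c σ ≤ d.coverRips U (c * r) :=
  fun _ hτ => ⟨⟨hτ.1.1.1, hτ.1.1.2.trans (mul_le_mul' le_rfl h)⟩, hτ.2⟩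

/-! ### Acyclicity of the carriers. -/

variable {K : Type v} [Field K]

theorem augExact_carrier_one {U : Set (Set X)} {σ : Finset X} (hσ : σ.Nonempty)
    (hU : ∃ A ∈ U, (σ : Set X) ⊆ A) : AugExact K (d.carrier U 1 σ) := by
  have : d.carrier U 1 σ = restrict (d.carrier U 1 σ) (σ : Set X) :=
    le_antisymm (fun τ hτ => mem_restrict.2 ⟨hτ, by
      rw [← carrierSet_one (d := d) σ]
      exact hτ.1.2⟩) (restrict_le _ _)
  rw [this]
  exact augExact_restrict_simplex (mem_carrier_self le_rfl hσ hU)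

theorem nonempty_of_mem_restrictedCover {U : Set (Set X)} {σ : Finset X} {B : Set X}
    (hB : B ∈ d.restrictedCover U σ) : B.Nonempty := by
  obtain ⟨A, -, -, h⟩ := hB
  exact h

theorem subset_of_mem_restrictedCover {U : Set (Set X)} {σ : Finset X} {B : Set X}
    (hB : B ∈ d.restrictedCover U σ) : B ⊆ d.witnessUnion σ := by
  obtain ⟨A, -, rfl, -⟩ := hB
  exact Set.inter_subset_right

/-- Each member is the trace of the intersection of a subfamily of `U`; the union of these
subfamilies has the required trace. -/
theorem sInter_mem_restrictedCover {U : Set (Set X)} {σ : Finset X} {I : Set (Set X)}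
    (hI : I ⊆ d.restrictedCover U σ) (hne : I.Nonempty) (hne' : (⋂₀ I).Nonempty) :
    ⋂₀ I ∈ d.restrictedCover U σ := by
  obtain ⟨B₀, hB₀⟩ := hne
  have hsub := subset_of_mem_restrictedCover (hI hB₀)
  have hB : ∀ B ∈ I, ∃ J ⊆ U, J.Nonempty ∧ B = ⋂₀ J ∩ d.witnessUnion σ := by
    intro B hB
    obtain ⟨_, ⟨J, hJ, hJne, rfl⟩, h, -⟩ := hI hB
    exact ⟨J, hJ, hJne, h⟩
  choose! J hJ hJne hJB using hB
  refine ⟨⋂₀ (⋃ B ∈ I, J B), ⟨_, Set.iUnion₂_subset hJ, ?_, rfl⟩, ?_, hne'⟩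
  · obtain ⟨A, hA⟩ := hJne B₀ hB₀
    exact ⟨A, Set.mem_biUnion hB₀ hA⟩
  · refine Set.Subset.antisymm (Set.subset_inter (Set.subset_sInter fun A hA => ?_)
      ((Set.sInter_subset_of_mem hB₀).trans hsub)) (Set.subset_sInter fun B hB => ?_)
    · obtain ⟨B, hB, hA⟩ := Set.mem_iUnion₂.1 hA
      refine (Set.sInter_subset_of_mem hB).trans ?_
      rw [hJB B hB]
      exact Set.inter_subset_left.trans (Set.sInter_subset_of_mem hA)
    · rw [hJB B hB]
      exact Set.inter_subset_inter_left _
        (Set.sInter_subset_sInter (Set.subset_biUnion_of_mem hB))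

theorem inter_mem_restrictedCover {U : Set (Set X)} {σ : Finset X} {A : Set X} (hA : A ∈ U)
    (hne : (A ∩ d.witnessUnion σ).Nonempty) :
    A ∩ d.witnessUnion σ ∈ d.restrictedCover U σ :=
  ⟨A, ⟨{A}, Set.singleton_subset_iff.2 hA, Set.singleton_nonempty A, Set.sInter_singleton A |>.symm⟩,
    rfl, hne⟩

/-- Passing to intersections and traces does not change which simplices are covered, but yields a
family closed under intersections, as the nerve theorem requires. -/
theorem carrier_eq_coverSubcomplex {U : Set (Set X)} {c : ℝ≥0} (hc : c ≠ 1) (σ : Finset X) :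
    d.carrier U c σ = coverSubcomplex (restrict (d.rips (c * d.diam σ)) (d.witnessUnion σ))
      (d.restrictedCover U σ) := by
  rw [carrier, carrierSet_of_ne_one hc]
  refine le_antisymm ?_ ?_
  · rintro τ ⟨hτ, A, hA, hτA⟩
    exact ⟨hτ, _, inter_mem_restrictedCover hA ((Finset.coe_nonempty.2 hτ.1.1).mono
      (Set.subset_inter hτA hτ.2)), Set.subset_inter hτA hτ.2⟩
  · rintro τ ⟨hτ, _, ⟨_, ⟨J, hJ, ⟨A, hA⟩, rfl⟩, rfl, -⟩, hτA⟩
    exact ⟨hτ, A, hJ hA, hτA.trans (Set.inter_subset_left.trans (Set.sInter_subset_of_mem hA))⟩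

theorem augExact_carrier {U : Set (Set X)} (hU : ⋃₀ U = Set.univ) {c : ℝ≥0} (hc : 1 < c)
    {σ : Finset X} (hσ : σ.Nonempty) (hN : Acyclic K (nerve (d.restrictedCover U σ)))
    (hcone : ∀ B ∈ d.restrictedCover U σ, ∃ w ∈ B, ∀ y ∈ B, d.dist y w ≤ c * d.diam σ) :
    AugExact K (d.carrier U c σ) := by
  obtain ⟨x, hx⟩ := hσ
  obtain ⟨A, hA, hxA⟩ := Set.mem_sUnion.1 (hU.symm ▸ Set.mem_univ x)
  have hxW := d.subset_witnessUnion σ (Finset.mem_coe.2 hx)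
  have hB := inter_mem_restrictedCover (d := d) (σ := σ) hA ⟨x, hxA, hxW⟩
  rw [carrier_eq_coverSubcomplex hc.ne']
  refine augExact_coverSubcomplex (fun B => nonempty_of_mem_restrictedCover)
    (fun I => sInter_mem_restrictedCover) ⟨_, hB⟩
    (hN.augExact (v := A ∩ d.witnessUnion σ) (mem_nerve.2
      ⟨Finset.singleton_nonempty _, by simpa using hB, by simpa using ⟨x, hxA, hxW⟩⟩))
    (fun B hB => ?_) ⟨{x}, ?_⟩
  · have : restrict (restrict (d.rips (c * d.diam σ)) (d.witnessUnion σ)) B =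
        restrict (d.rips (c * d.diam σ)) B :=
      le_antisymm (fun τ hτ => ⟨hτ.1.1, hτ.2⟩)
        fun τ hτ => ⟨⟨hτ.1, hτ.2.trans (subset_of_mem_restrictedCover hB)⟩, hτ.2⟩
    rw [this]
    obtain ⟨w, hw, h⟩ := hcone B hB
    exact d.augExact_restrict_rips K hw h
  · refine mem_coverSubcomplex.2 ⟨mem_restrict.2 ⟨d.mem_rips.2 ⟨Finset.singleton_nonempty x,
      d.diam_le_iff.2 ?_⟩, by simpa using hxW⟩, _, hB, by simpa using ⟨hxA, hxW⟩⟩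
    simp [d.dist_self]

/-! ### The three factors and the resulting interleavings. -/

/-- The coefficient `c` is one of the factors `1`, `2`, `3`, and the parameter `r` lies in the
corresponding regime. -/
def IsFactor (d : Dissimilarity X) (K : Type v) [Field K] (U : Set (Set X)) (c r : ℝ≥0) : Prop :=
  c = 1 ∧ r ∈ d.regime₁ U ∨ c = 2 ∧ r ∈ d.regime₂ K U ∨ c = 3 ∧ r ∈ d.regime₃ K U

theorem IsFactor.one_le {U : Set (Set X)} {c r : ℝ≥0} (h : d.IsFactor K U c r) : 1 ≤ c := by
  rcases h with ⟨rfl, -⟩ | ⟨rfl, -⟩ | ⟨rfl, -⟩ <;> norm_num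

theorem IsFactor.augExact_carrier {U : Set (Set X)} {c r : ℝ≥0} (h : d.IsFactor K U c r)
    (hd : d.Triangle) (hU : ⋃₀ U = Set.univ) {σ : Finset X} (hσ : σ ∈ d.rips r) :
    AugExact K (d.carrier U c σ) := by
  obtain ⟨hne, hr⟩ := hσ
  rcases h with ⟨rfl, h⟩ | ⟨rfl, h⟩ | ⟨rfl, h⟩
  · exact augExact_carrier_one hne (h σ hne hr)
  · refine Dissimilarity.augExact_carrier hU (by norm_num) hne (h σ hne hr).1 fun B hB => ?_
    obtain ⟨w, hw, hwB⟩ := (h σ hne hr).2 B hB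
    exact ⟨w, hwB, fun y hy => hd.dist_le_two_mul (subset_of_mem_restrictedCover hB hy) hw⟩
  · refine Dissimilarity.augExact_carrier hU (by norm_num) hne (h σ hne hr) fun B hB => ?_
    obtain ⟨w, hw⟩ := nonempty_of_mem_restrictedCover hB
    exact ⟨w, hw, fun y hy => hd.dist_le_three_mul (subset_of_mem_restrictedCover hB hy)
      (subset_of_mem_restrictedCover hB hw)⟩

/-- Without a cover constraint no nerve is involved: each vertex of `σ` is a witness of `σ`, hence a
cone apex as soon as `c ≥ 2`. -/
theorem IsFactor.augExact_carrier_univ {U : Set (Set X)} {c r : ℝ≥0} (h : d.IsFactor K U c r)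
    (hd : d.Triangle) {σ : Finset X} (hσ : σ ∈ d.rips r) :
    AugExact K (d.carrier {Set.univ} c σ) := by
  obtain ⟨hne, hr⟩ := hσ
  by_cases hc : c = 1
  · subst hc
    exact augExact_carrier_one hne ⟨_, rfl, Set.subset_univ _⟩
  have h2 : 2 ≤ c := by
    rcases h with ⟨rfl, -⟩ | ⟨rfl, -⟩ | ⟨rfl, -⟩
    · exact absurd rfl hc
    · exact le_rfl
    · norm_num
  have : d.carrier {Set.univ} c σ = restrict (d.rips (c * d.diam σ)) (d.witnessUnion σ) := by
    rw [carrier, carrierSet_of_ne_one hc]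
    exact le_antisymm (fun τ hτ => hτ.1) fun τ hτ => ⟨hτ, _, rfl, Set.subset_univ _⟩
  rw [this]
  obtain ⟨x, hx⟩ := hne
  have hxw : x ∈ d.witness σ := fun y hy => d.dist_le_diam hx hy
  exact d.augExact_restrict_rips K (d.subset_witnessUnion σ (Finset.mem_coe.2 hx)) fun y hy =>
    (hd.dist_le_two_mul hy hxw).trans (mul_le_mul' h2 le_rfl)

theorem interleaved_of_isFactor {U : Set (Set X)} (hd : d.Triangle) (hU : ⋃₀ U = Set.univ)
    {T : Set ℝ≥0} {α : ℝ≥0 →o ℝ≥0} {c : ℝ≥0 → ℝ≥0} (hc : MonotoneOn c T)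
    (hα : ∀ t ∈ T, α t = c t * t) (hT : ∀ t ∈ T, d.IsFactor K U (c t) t) (k : ℕ) :
    Interleaved (persistentHomology K (d.coverRips U) k) (persistentHomology K d.rips k)
      Set.univ T OrderHom.id α := by
  refine interleaved_of_carriers (d.coverRips_le_rips U)
    (fun t ht => hα t ht ▸ le_mul_of_one_le_left' (hT t ht).one_le)
    (fun t => d.carrier U (c t)) (fun t => d.carrier {Set.univ} (c t)) ?_ ?_ ?_ ?_ ?_ ?_ ?_ ?_ ?_ ?_
    k
  · exact fun t ht σ _ τ _ h => carrier_mono (fun A hA => ⟨A, hA, subset_rfl⟩) (hT t ht).one_le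
      le_rfl h
  · exact fun t ht σ hσ => (hT t ht).augExact_carrier hd hU hσ
  · exact fun t ht σ hσ => hα t ht ▸ carrier_le_coverRips hσ.2
  · exact fun s hs t ht h σ _ => carrier_mono (fun A hA => ⟨A, hA, subset_rfl⟩) (hT s hs).one_le
      (hc hs ht h) subset_rfl
  · exact fun t ht σ hσ => mem_carrier_self (hT t ht).one_le hσ.1.1 hσ.2
  · exact fun t ht σ _ τ _ h => carrier_mono (fun A hA => ⟨A, hA, subset_rfl⟩) (hT t ht).one_le
      le_rfl h
  · exact fun t ht σ hσ => (hT t ht).augExact_carrier_univ hd hσ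
  · exact fun t ht σ hσ => hα t ht ▸ (carrier_le_coverRips hσ.2).trans (d.coverRips_le_rips _ _)
  · exact fun t ht σ _ => carrier_mono
      (fun A _ => ⟨Set.univ, Set.mem_singleton _, Set.subset_univ A⟩) (hT t ht).one_le
      le_rfl subset_rfl
  · exact fun t ht σ hσ => mem_carrier_self (hT t ht).one_le hσ.1 ⟨_, rfl, Set.subset_univ _⟩

open Classical in
/-- The best factor available at the parameter `r`. -/
noncomputable def factor (d : Dissimilarity X) (K : Type v) [Field K] (U : Set (Set X))
    (r : ℝ≥0) : ℝ≥0 :=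
  -- Outside all three segments the value `3` only keeps the function total and monotone.
  if r ∈ d.regime₁ U then 1 else if r ∈ d.regime₂ K U then 2 else 3

theorem factor_mono (U : Set (Set X)) : Monotone (d.factor K U) := by
  intro r s h
  have h1 := d.isLowerSet_regime₁ U h
  have h2 := d.isLowerSet_regime₂ K U h
  unfold factor
  split_ifs <;> first | (exfalso; tauto) | norm_num

theorem one_le_factor (U : Set (Set X)) (r : ℝ≥0) : 1 ≤ d.factor K U r := by
  unfold factor
  split_ifs <;> norm_num

theorem factor_le_three (U : Set (Set X)) (r : ℝ≥0) : d.factor K U r ≤ 3 := by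
  unfold factor
  split_ifs <;> norm_num

theorem factor_le_two {U : Set (Set X)} {r : ℝ≥0} (hr : r ∈ d.regime₂ K U) :
    d.factor K U r ≤ 2 := by
  unfold factor
  split_ifs <;> norm_num

theorem factor_eq_one {U : Set (Set X)} {r : ℝ≥0} (hr : r ∈ d.regime₁ U) :
    d.factor K U r = 1 :=
  if_pos hr

theorem isFactor_factor {U : Set (Set X)} {r : ℝ≥0}
    (hr : r ∈ d.regime₁ U ∪ d.regime₂ K U ∪ d.regime₃ K U) :
    d.IsFactor K U (d.factor K U r) r := by
  unfold factor IsFactor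
  split_ifs with h1 h2
  · exact Or.inl ⟨rfl, h1⟩
  · exact Or.inr (Or.inl ⟨rfl, h2⟩)
  · exact Or.inr (Or.inr ⟨rfl, hr.resolve_left fun h => h.elim h1 h2⟩)

/-- The shift `r ↦ factor r * r`. -/
noncomputable def factorShift (d : Dissimilarity X) (K : Type v) [Field K] (U : Set (Set X)) :
    ℝ≥0 →o ℝ≥0 where
  toFun r := d.factor K U r * r
  monotone' _ _ h := mul_le_mul' (factor_mono U h) h

end Dissimilarity

/-! ### A cover without interleaving past the third threshold -/

/-- Two points at distance one. -/
noncomputable def twoPoints : Dissimilarity Bool where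
  dist x y := if x = y then 0 else 1
  dist_self _ := if_pos rfl
  dist_comm x y := by simp only [eq_comm]

/-- The cover of the two-point space by its points. -/
def pointCover : Set (Set Bool) := Set.range fun x => {x}

theorem twoPoints_triangle : twoPoints.Triangle := by
  intro x y z
  cases x <;> cases y <;> cases z <;> simp [twoPoints]

theorem eq_of_twoPoints_dist_lt_one {x y : Bool} (h : twoPoints.dist x y < 1) : x = y := by
  by_contra hxy
  simp [twoPoints, hxy] at h

theorem sUnion_pointCover : ⋃₀ pointCover = Set.univ :=
  Set.eq_univ_of_forall fun x => ⟨{x}, ⟨x, rfl⟩, rfl⟩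

theorem mem_twoPoints_rips {σ : Finset Bool} (hσ : σ.Nonempty) {r : ℝ≥0} (hr : 1 ≤ r) :
    σ ∈ twoPoints.rips r := by
  refine ⟨hσ, twoPoints.diam_le_iff.2 fun x _ y _ => le_trans ?_ hr⟩
  simp only [twoPoints]
  split_ifs <;> norm_num

section

variable (K : Type v) [Field K]

/-- Below scale `1` a simplex is a single point and equals its witness union, so the restricted
cover has one member and its nerve is a point. -/
theorem mem_regime₃_twoPoints {r : ℝ≥0} (hr : r < 1) : r ∈ twoPoints.regime₃ K pointCover := by
  rintro σ ⟨a, ha⟩ hσr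
  have hsub : twoPoints.witnessUnion σ ⊆ {a} := fun y hy => by
    obtain ⟨x, hx, hyx⟩ := twoPoints.exists_dist_le_of_mem_witnessUnion hy
    rw [Set.mem_singleton_iff, eq_of_twoPoints_dist_lt_one ((hyx.trans hσr).trans_lt hr)]
    exact eq_of_twoPoints_dist_lt_one (((twoPoints.dist_le_diam hx ha).trans hσr).trans_lt hr)
  have heq : ∀ B ∈ twoPoints.restrictedCover pointCover σ, B = {a} := fun B hB =>
    (Dissimilarity.nonempty_of_mem_restrictedCover hB).subset_singleton_iff.1
      ((Dissimilarity.subset_of_mem_restrictedCover hB).trans hsub)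
  have haW := twoPoints.subset_witnessUnion σ (Finset.mem_coe.2 ha)
  have hB := Dissimilarity.inter_mem_restrictedCover (d := twoPoints) (σ := σ)
    (U := pointCover) ⟨a, rfl⟩ ⟨a, rfl, haW⟩
  rw [heq _ hB] at hB
  have hmem : ({{a}} : Finset (Set Bool)) ∈ nerve (twoPoints.restrictedCover pointCover σ) :=
    mem_nerve.2 ⟨Finset.singleton_nonempty _, by simpa using hB, by simp⟩
  have hex : AugExact K (nerve (twoPoints.restrictedCover pointCover σ)) := by
    classical
    refine augExact_of_cone {a} hmem fun s hs => ?_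
    obtain ⟨B, hBs⟩ := hs.1
    rwa [Finset.insert_eq_of_mem (heq B (hs.2.1 hBs) ▸ hBs)]
  exact hex.acyclic

/-- Only degenerate pairs `(a, a)` lie in a cover set, and their boundary is zero. -/
theorem boundaries_coverRips_twoPoints (r : ℝ≥0) :
    boundaries K (twoPoints.coverRips pointCover r) 0 = ⊥ := by
  refine (Submodule.eq_bot_iff _).2 fun z hz => ?_
  obtain ⟨w, hw, rfl⟩ := mem_boundaries_iff.1 hz
  refine map_mem_of_single (tupleBoundary K Bool 1) ⊥ (fun x hx => ?_) hw
  obtain ⟨-, _, ⟨a, rfl⟩, hxa⟩ := hx.resolve_left (by norm_num)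
  have hx : ∀ i, x i = a := fun i => hxa (by simp [entries])
  have : x = fun _ => a := funext hx
  rw [Submodule.mem_bot, tupleBoundary_single, Fin.sum_univ_two, this]
  simp only [Fin.val_zero, Fin.val_one, pow_zero, pow_one, Finsupp.single_neg]
  exact add_neg_cancel _

theorem homologyClass_coverRips_twoPoints {r : ℝ≥0} {z : Chain K Bool 0} {hz}
    (h : homologyClass (twoPoints.coverRips pointCover r) 0 z hz = 0) : z = 0 := by
  have : z ∈ boundaries K (twoPoints.coverRips pointCover r) 0 :=
    by
    have h' : homologyClass (twoPoints.coverRips pointCover r) 0 z hz =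
        homologyClass _ 0 0 (Submodule.zero_mem _) := h
    simpa using homologyClass_eq_iff.1 h'
  rwa [boundaries_coverRips_twoPoints, Submodule.mem_bot] at this

/-- All tuples are admissible, so coning off with `true` shows every `0`-chain homologous to its
augmentation times that point. -/
theorem exists_generator_rips_twoPoints {r : ℝ≥0} (hr : 1 ≤ r) :
    ∃ u : Homology K (twoPoints.rips r) 0, ∀ a, ∃ c : K, a = c • u := by
  have hmem : ∀ n (z : TupleChain K Bool n), z ∈ tupleChains K (twoPoints.rips r) n := by
    intro n z
    refine (Finsupp.mem_supported K _).2 fun x _ => ?_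
    rcases n with _ | n
    · exact Or.inl rfl
    · exact Or.inr (mem_twoPoints_rips (entries_nonempty x) hr)
  refine ⟨homologyClass _ 0 (Finsupp.single (Fin.cons true Fin.elim0) 1)
    (mem_cycles_iff.2 ⟨hmem _ _, Or.inl rfl⟩), fun a => ?_⟩
  obtain ⟨⟨z, hz⟩, rfl⟩ := Submodule.Quotient.mk_surjective _ a
  refine ⟨augmentation K Bool z, (Submodule.Quotient.eq _).2 ?_⟩
  refine mem_boundaries_iff.2 ⟨coneOp K true 1 z, hmem _ _, ?_⟩
  rw [tupleBoundary_coneOp, tupleBoundary_zero_apply, coneOp_single]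
  simp

theorem not_interleaved_twoPoints {T : Set ℝ≥0} {α : ℝ≥0 →o ℝ≥0}
    {t : ℝ≥0} (htT : t ∈ T) (ht1 : 1 ≤ t) :
    ¬ Interleaved (persistentHomology K (twoPoints.coverRips pointCover) 0)
      (persistentHomology K twoPoints.rips 0) Set.univ T OrderHom.id α := by
  rintro ⟨F, G, hGF, -⟩
  obtain ⟨hle, h⟩ := hGF ⟨t, trivial⟩ htT
  obtain ⟨u, hu⟩ := exists_generator_rips_twoPoints K ht1
  let f : Homology K (twoPoints.coverRips pointCover t) 0 →ₗ[K]
    Homology K (twoPoints.rips t) 0 := (F.app ⟨t, trivial⟩).hom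
  let g : Homology K (twoPoints.rips t) 0 →ₗ[K]
    Homology K (twoPoints.coverRips pointCover (α t)) 0 := (G.app ⟨t, htT⟩).hom
  -- The composite `g ∘ f` is induced by inclusion and is injective, as the cover complex has no
  -- nonzero `0`-boundaries at any scale; hence so is `f`.
  have hf : ∀ z hz, f (homologyClass _ 0 z hz) = 0 → z = 0 := by
    intro z hz h0
    have h1 := LinearMap.congr_fun (congrArg ModuleCat.Hom.hom h) (homologyClass _ 0 z hz)
    have h2 : g (f (homologyClass _ 0 z hz)) =
      homologyMap K ((twoPoints.coverRips pointCover).monotone hle) 0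
        (homologyClass _ 0 z hz) := h1
    rw [h0, map_zero, homologyMap_class] at h2
    exact homologyClass_coverRips_twoPoints K h2.symm
  let p : Bool → Chain K Bool 0 := fun x => Finsupp.single (fun _ => x) 1
  have hp : ∀ x, p x ∈ cycles K (twoPoints.coverRips pointCover t) 0 := fun x => by
    have hx : entries (fun _ : Fin 1 => x) ∈ twoPoints.coverRips pointCover t :=
      ⟨mem_twoPoints_rips (entries_nonempty _) ht1, {x}, ⟨x, rfl⟩, by simp [entries]⟩
    exact mem_cycles_iff.2 ⟨single_mem_tupleChains (Or.inr hx) 1, Or.inl rfl⟩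
  obtain ⟨a, ha⟩ := hu (f (homologyClass _ 0 (p true) (hp true)))
  obtain ⟨b, hb⟩ := hu (f (homologyClass _ 0 (p false) (hp false)))
  -- The images of the two points are `a • u` and `b • u`, so this combination maps to zero although
  -- the points are independent.
  have hab : b • p true - a • p false = 0 := by
    refine hf _ (Submodule.sub_mem _ (Submodule.smul_mem _ _ (hp true))
      (Submodule.smul_mem _ _ (hp false))) ?_
    have : homologyClass (twoPoints.coverRips pointCover t) 0 (b • p true - a • p false)
        (Submodule.sub_mem _ (Submodule.smul_mem _ _ (hp true))
        (Submodule.smul_mem _ _ (hp false))) =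
        b • homologyClass _ 0 (p true) (hp true) - a • homologyClass _ 0 (p false) (hp false) :=
      rfl
    rw [this, map_sub, map_smul, map_smul, ha, hb, smul_smul, smul_smul, mul_comm, sub_self]
  have ha0 : a = 0 := by
    have := DFunLike.congr_fun hab (fun _ => false)
    simpa [p, Finsupp.single_apply, funext_iff] using this
  have hp0 : p true = 0 := hf _ (hp true) (by rw [ha, ha0, zero_smul])
  exact one_ne_zero (Finsupp.single_eq_zero.1 hp0)

end
end RipsCover

/-! ### Assembly of the three statements. -/

theorem mainTheorem1 (K : Type v) [Field K] :
    (∀ (X : Type u) (d : RipsCover.Dissimilarity X) (U : Set (Set X)), ⋃₀ U = Set.univ →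
      (∀ r ∈ d.regime₁ U, d.coverRips U r = d.rips r) ∧
      (d.Triangle →
        (∃ α : ℝ≥0 →o ℝ≥0, (∀ r, r ≤ α r) ∧
          (∀ r ∈ d.regime₁ U, α r = r) ∧
          (∀ r ∈ d.regime₂ K U, α r ≤ 2 * r) ∧
          (∀ r ∈ d.regime₃ K U, α r ≤ 3 * r) ∧
          ∀ k : ℕ, RipsCover.Interleaved
            (RipsCover.persistentHomology K (d.coverRips U) k)
            (RipsCover.persistentHomology K d.rips k)
            Set.univ (d.regime₁ U ∪ d.regime₂ K U ∪ d.regime₃ K U) OrderHom.id α) ∧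
        (∀ k : ℕ, RipsCover.Interleaved
            (RipsCover.persistentHomology K (d.coverRips U) k)
            (RipsCover.persistentHomology K d.rips k)
            Set.univ (d.regime₂ K U) OrderHom.id (RipsCover.scale 2)) ∧
        (∀ k : ℕ, RipsCover.Interleaved
            (RipsCover.persistentHomology K (d.coverRips U) k)
            (RipsCover.persistentHomology K d.rips k)
            Set.univ (d.regime₃ K U) OrderHom.id (RipsCover.scale 3)))) ∧
    (∃ (Y : Type) (_ : Finite Y) (d : RipsCover.Dissimilarity Y) (U : Set (Set Y)) (k : ℕ),
      d.Triangle ∧ (∀ x y, d.dist x y = 0 → x = y) ∧ ⋃₀ U = Set.univ ∧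
      (d.regime₃ K U).Nonempty ∧ d.regime₃ K U ≠ Set.univ ∧
      ∀ (T : Set ℝ≥0) (α : ℝ≥0 →o ℝ≥0), ¬ T ⊆ d.regime₃ K U →
        ¬ RipsCover.Interleaved
          (RipsCover.persistentHomology K (d.coverRips U) k)
          (RipsCover.persistentHomology K d.rips k)
          Set.univ T OrderHom.id α) := by
  open RipsCover RipsCover.Dissimilarity in
  refine ⟨fun X d U hU => ⟨fun r hr => d.coverRips_eq_rips hr, fun hd =>
    ⟨⟨d.factorShift K U, ?_, ?_, ?_, ?_, ?_⟩, ?_, ?_⟩⟩,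
    Bool, inferInstance, twoPoints, pointCover, 0, twoPoints_triangle, ?_, sUnion_pointCover,
    ⟨0, mem_regime₃_twoPoints K zero_lt_one⟩, fun h => ?_, fun T α hT => ?_⟩
  · exact fun r => le_mul_of_one_le_left' (one_le_factor U r)
  · exact fun r hr => (congrArg (· * r) (factor_eq_one hr)).trans (one_mul r)
  · exact fun r hr => mul_le_mul' (factor_le_two hr) le_rfl
  · exact fun r _ => mul_le_mul' (factor_le_three U r) le_rfl
  · exact interleaved_of_isFactor hd hU ((factor_mono U).monotoneOn _) (fun _ _ => rfl)
      fun t ht => isFactor_factor ht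
  · exact interleaved_of_isFactor (c := fun _ => 2) hd hU monotoneOn_const (fun _ _ => rfl)
      fun t ht => Or.inr (Or.inl ⟨rfl, ht⟩)
  · exact interleaved_of_isFactor (c := fun _ => 3) hd hU monotoneOn_const (fun _ _ => rfl)
      fun t ht => Or.inr (Or.inr ⟨rfl, ht⟩)
  · exact fun x y h => eq_of_twoPoints_dist_lt_one (h ▸ zero_lt_one)
  -- No nerve has to be computed: were the third regime everything, the positive result would
  -- interleave at all scales, contradicting the obstruction at scale `1`.
  · obtain ⟨F, G, hGF, hFG⟩ := interleaved_of_isFactor (K := K) (T := Set.univ)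
      (c := fun _ => 3) (α := scale 3) twoPoints_triangle sUnion_pointCover monotoneOn_const
      (fun _ _ => rfl) (fun t _ => Or.inr (Or.inr ⟨rfl, h ▸ Set.mem_univ t⟩)) 0
    exact not_interleaved_twoPoints K (Set.mem_univ 1) le_rfl
      ⟨⟨F.app, F.comm⟩, ⟨G.app, G.comm⟩, hGF, hFG⟩
  · obtain ⟨t, htT, ht⟩ := Set.not_subset.1 hT
    exact not_interleaved_twoPoints K htT (not_lt.1 fun h => ht (mem_regime₃_twoPoints K h))
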